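/- Let $d\ge 1$. A rooted subgraph of $\mathbb{Z}^d$ is a triple $(G,\phi,\rho)$ where $G$ is a connected, locally finite simple graph, $\rho\in V(G)$, and $\phi:V(G)\times V(G)\to\mathbb{Z}^d$ satisfies $\phi(u,w)=\phi(u,v)+\phi(v,w)$ for all $u,v,w$, $\phi(u,w)=0$ if and only if $u=w$, and $\|\phi(u,w)\|_\infty=1$ whenever $u$ and $w$ are adjacent. Doubly-rooted subgraphs $(G,\phi,\rho_1,\rho_2)$ of $\mathbb{Z}^d$ are defined in the same way, with an ordered pair of roots. The spaces $\mathcal{S}_\bullet(\mathbb{Z}^d)$ and $\mathcal{S}_{\bullet\bullet}(\mathbb{Z}^d)$ of isomorphism classes (isomorphisms preserving $\phi$ and the roots) carry the Borel $\sigma$-algebra of the local topology, in which two classes are close if large graph-distance balls around their (first) roots are isomorphic by an isomorphism preserving the root(s) and $\phi$. A random rooted subgraph $(G,\phi,\rho)$ of $\mathbb{Z}^d$ is unimodular if $$\mathbb{E}\Big[\sum_{v\in V(G)}F(G,\phi,\rho,v)\Big]=\mathbb{E}\Big[\sum_{v\in V(G)}F(G,\phi,v,\rho)\Big]$$ for every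 Borel measurable $F:\mathcal{S}_{\bullet\bullet}(\mathbb{Z}^d)\to[0,\infty)$. Proposition. Let $1\le d\le 4$, let $(G,\phi,\rho)$ be a unimodular random rooted subgraph of $\mathbb{Z}^d$, and let $X=(X_i)_{i\ge0}$ and $Y=(Y_j)_{j\ge0}$ be two simple random walks on $G$ started at $\rho$ that are conditionally independent given $(G,\phi,\rho)$ (if $G$ consists of the single vertex $\rho$, the walks stay at $\rho$). Then $$\mathbb{E}\left[\#\{(i,j): i,j\ge 0,\ X_i=Y_j\}\,\middle|\,(G,\phi,\rho),Y\right]=\infty\quad\text{almost surely}.$$ -/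

import Mathlib

open MeasureTheory
open scoped ENNReal NNReal

/-- A connected, locally finite graph together with an embedding `φ` into `ℤ^d`.
The norm on `Fin d → ℤ` is the sup norm. Since such a graph is countable, vertex types in
`Type` are fully general up to isomorphism. -/
structure EmbeddedGraph (d : ℕ) where
  V : Type
  graph : SimpleGraph V
  connected : graph.Connected
  locallyFinite : ∀ v, (graph.neighborSet v).Finite
  φ : V → V → (Fin d → ℤ)
  cocycle : ∀ u v w, φ u w = φ u v + φ v w
  φ_eq_zero_iff : ∀ u w, φ u w = 0 ↔ u = w
  norm_φ_of_adj : ∀ u w, graph.Adj u w → ‖φ u w‖ = 1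

namespace EmbeddedGraph

variable {d : ℕ}

/-- The ball of radius `r` around `v` for the graph distance. -/
def ball (G : EmbeddedGraph d) (v : G.V) (r : ℕ) : Set G.V := {u | G.graph.dist v u ≤ r}

theorem self_mem_ball (G : EmbeddedGraph d) (v : G.V) (r : ℕ) : v ∈ G.ball v r := by
  simp [ball]

open Classical in
/-- One-step transition probabilities of simple random walk: jump to a uniformly chosen neighbour;
at a vertex without neighbours (the graph being then a single vertex), stay put. -/
noncomputable def stepProb (G : EmbeddedGraph d) (u v : G.V) : ℝ≥0∞ :=
  if G.graph.neighborSet u = ∅ then (if v = u then 1 else 0)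
  else if G.graph.Adj u v then ((G.graph.neighborSet u).ncard : ℝ≥0∞)⁻¹ else 0

end EmbeddedGraph

/-- A rooted subgraph `(G, φ, ρ)` of `ℤ^d`. -/
structure RootedSubgraph (d : ℕ) extends EmbeddedGraph d where
  root : V

/-- A doubly-rooted subgraph `(G, φ, ρ₁, ρ₂)` of `ℤ^d`. -/
structure BirootedSubgraph (d : ℕ) extends EmbeddedGraph d where
  root₁ : V
  root₂ : V

namespace RootedSubgraph

variable {d : ℕ}

/-- Isomorphism of rooted subgraphs of `ℤ^d`: a graph isomorphism that preserves the
embedding and the root. -/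
def Iso (S T : RootedSubgraph d) : Prop :=
  ∃ e : S.graph ≃g T.graph, (∀ u v, T.φ (e u) (e v) = S.φ u v) ∧ e S.root = T.root

theorem iso_equivalence : Equivalence (Iso (d := d)) where
  refl S := ⟨SimpleGraph.Iso.refl, fun _ _ => rfl, rfl⟩
  symm := by
    rintro S T ⟨e, h, hr⟩
    refine ⟨e.symm, fun u v => ?_, ?_⟩
    · simpa using (h (e.symm u) (e.symm v)).symm
    · rw [← hr]; simp
  trans := by
    rintro S T U ⟨e, h, hr⟩ ⟨f, k, kr⟩
    refine ⟨e.trans f, fun u v => ?_, ?_⟩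
    · exact (k (e u) (e v)).trans (h u v)
    · change f (e S.root) = U.root
      rw [hr, kr]

instance isoSetoid (d : ℕ) : Setoid (RootedSubgraph d) := ⟨Iso, iso_equivalence⟩

/-- The space of isomorphism classes of rooted subgraphs of `ℤ^d`. -/
def Space (d : ℕ) : Type 1 := Quotient (isoSetoid d)

/-- The isomorphism class of a rooted subgraph of `ℤ^d`. -/
def cls (S : RootedSubgraph d) : Space d := Quotient.mk (isoSetoid d) S

/-- The balls of radius `r` around the roots of `S` and `T` are isomorphic, by an isomorphism
that preserves the root and the embedding. -/
def AgreeUpTo (r : ℕ) (S T : RootedSubgraph d) : Prop :=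
  ∃ e : S.graph.induce (S.ball S.root r) ≃g T.graph.induce (T.ball T.root r),
    (∀ u v, T.φ (e u) (e v) = S.φ u v) ∧
    (e ⟨S.root, S.self_mem_ball S.root r⟩ : T.V) = T.root

/-- The local topology: the classes that agree with `S` up to radius `r` form a basis of
neighbourhoods of the class of `S`, as `r` varies. -/
instance (d : ℕ) : TopologicalSpace (Space d) :=
  TopologicalSpace.generateFrom
    {U | ∃ (S : RootedSubgraph d) (r : ℕ), U = {q | ∃ T, AgreeUpTo r S T ∧ cls T = q}}

instance (d : ℕ) : MeasurableSpace (Space d) := borel (Space d)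

instance (d : ℕ) : BorelSpace (Space d) := ⟨rfl⟩

/-- The position `φ(ρ, v)` of a vertex `v` relative to the root. -/
def pos (S : RootedSubgraph d) (v : S.V) : Fin d → ℤ := S.φ S.root v

/-- The probability that the random walk on `S` started at the root follows the vertex path
`w 0, …, w n` during its first `n` steps. -/
noncomputable def pathProb (S : RootedSubgraph d) {n : ℕ} (w : Fin (n + 1) → S.V) : ℝ≥0∞ :=
  open Classical in
  (if w 0 = S.root then 1 else 0) * ∏ i : Fin n, S.stepProb (w i.castSucc) (w i.succ)

/-- The probability that the random walk on `S` started at the root passes, at times `0, …, n`,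
through vertices whose positions are `x 0, …, x n`. -/
noncomputable def posPathProb (S : RootedSubgraph d) {n : ℕ} (x : Fin (n + 1) → Fin d → ℤ) :
    ℝ≥0∞ :=
  ∑' w : {w : Fin (n + 1) → S.V // ∀ i, S.pos (w i) = x i}, S.pathProb w.1

end RootedSubgraph

namespace BirootedSubgraph

variable {d : ℕ}

/-- Isomorphism of doubly-rooted subgraphs of `ℤ^d`. -/
def Iso (S T : BirootedSubgraph d) : Prop :=
  ∃ e : S.graph ≃g T.graph, (∀ u v, T.φ (e u) (e v) = S.φ u v) ∧
    e S.root₁ = T.root₁ ∧ e S.root₂ = T.root₂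

theorem iso_equivalence : Equivalence (Iso (d := d)) where
  refl S := ⟨SimpleGraph.Iso.refl, fun _ _ => rfl, rfl, rfl⟩
  symm := by
    rintro S T ⟨e, h, hr, hs⟩
    refine ⟨e.symm, fun u v => ?_, ?_, ?_⟩
    · simpa using (h (e.symm u) (e.symm v)).symm
    · rw [← hr]; simp
    · rw [← hs]; simp
  trans := by
    rintro S T U ⟨e, h, hr, hs⟩ ⟨f, k, kr, ks⟩
    refine ⟨e.trans f, fun u v => ?_, ?_, ?_⟩
    · exact (k (e u) (e v)).trans (h u v)
    · change f (e S.root₁) = U.root₁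
      rw [hr, kr]
    · change f (e S.root₂) = U.root₂
      rw [hs, ks]

instance isoSetoid (d : ℕ) : Setoid (BirootedSubgraph d) := ⟨Iso, iso_equivalence⟩

/-- The space of isomorphism classes of doubly-rooted subgraphs of `ℤ^d`. -/
def Space (d : ℕ) : Type 1 := Quotient (isoSetoid d)

/-- The isomorphism class of a doubly-rooted subgraph of `ℤ^d`. -/
def cls (S : BirootedSubgraph d) : Space d := Quotient.mk (isoSetoid d) S

/-- The balls of radius `r` around the first roots of `S` and `T` contain the second roots and are
isomorphic, by an isomorphism that preserves both roots and the embedding. -/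
def AgreeUpTo (r : ℕ) (S T : BirootedSubgraph d) : Prop :=
  ∃ e : S.graph.induce (S.ball S.root₁ r) ≃g T.graph.induce (T.ball T.root₁ r),
    (∀ u v, T.φ (e u) (e v) = S.φ u v) ∧
    (e ⟨S.root₁, S.self_mem_ball S.root₁ r⟩ : T.V) = T.root₁ ∧
    ∃ h : S.root₂ ∈ S.ball S.root₁ r, (e ⟨S.root₂, h⟩ : T.V) = T.root₂

/-- The local topology: the classes that agree with `S` up to radius `r`, with `r` at least the
distance between the two roots of `S`, form a basis of neighbourhoods of the class of `S`.
(For smaller `r` the generating set below is empty.) -/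
instance (d : ℕ) : TopologicalSpace (Space d) :=
  TopologicalSpace.generateFrom
    {U | ∃ (S : BirootedSubgraph d) (r : ℕ), U = {q | ∃ T, AgreeUpTo r S T ∧ cls T = q}}

instance (d : ℕ) : MeasurableSpace (Space d) := borel (Space d)

instance (d : ℕ) : BorelSpace (Space d) := ⟨rfl⟩

end BirootedSubgraph

section RandomSubgraphs

variable {d : ℕ} {Ω : Type*} [MeasurableSpace Ω]

/-- `S`, defined on a probability space `(Ω, P)`, is (a representative of) a unimodular random
rooted subgraph of `ℤ^d`: its isomorphism class is a random variable, and the mass-transport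
principle holds for all Borel functions `F` with values in `[0, ∞)`. -/
structure IsUnimodular (P : Measure Ω) (S : Ω → RootedSubgraph d) : Prop where
  measurable_cls : Measurable fun ω => (S ω).cls
  massTransport : ∀ F : BirootedSubgraph.Space d → ℝ≥0, Measurable F →
    ∫⁻ ω, ∑' v : (S ω).V,
        (F (BirootedSubgraph.mk (S ω).toEmbeddedGraph (S ω).root v).cls : ℝ≥0∞) ∂P =
      ∫⁻ ω, ∑' v : (S ω).V,
        (F (BirootedSubgraph.mk (S ω).toEmbeddedGraph v (S ω).root).cls : ℝ≥0∞) ∂P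

/-- `X` and `Y` are random walks on the random graph `S` started at its root, conditionally
independent given (the isomorphism class of) `S`. A vertex is determined by its position relative
to the root, so that the walks are measurable iff their positions are; and the law is fixed by
the conditional probabilities of all events on finitely many steps of the two walks. -/
structure AreIndepRandomWalks (P : Measure Ω) (S : Ω → RootedSubgraph d)
    (X Y : (ω : Ω) → ℕ → (S ω).V) : Prop where
  measurable_fst : ∀ n, Measurable fun ω => (S ω).pos (X ω n)
  measurable_snd : ∀ n, Measurable fun ω => (S ω).pos (Y ω n)
  law : ∀ A : Set (RootedSubgraph.Space d), MeasurableSet A →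
    ∀ (m n : ℕ) (x : Fin (m + 1) → Fin d → ℤ) (y : Fin (n + 1) → Fin d → ℤ),
      P {ω | (S ω).cls ∈ A ∧ (∀ i : Fin (m + 1), (S ω).pos (X ω i) = x i) ∧
          (∀ j : Fin (n + 1), (S ω).pos (Y ω j) = y j)} =
        ∫⁻ ω in {ω | (S ω).cls ∈ A}, (S ω).posPathProb x * (S ω).posPathProb y ∂P

/-- The σ-algebra generated by the random rooted subgraph `S = (G, φ, ρ)` of `ℤ^d` and a random
walk `Y` on it. -/
@[reducible] def sigmaGraphWalk (S : Ω → RootedSubgraph d) (Y : (ω : Ω) → ℕ → (S ω).V) : MeasurableSpace Ω :=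
  MeasurableSpace.comap (fun ω => (S ω).cls) inferInstance ⊔
    ⨆ n : ℕ, MeasurableSpace.comap (fun ω => (S ω).pos (Y ω n)) inferInstance

end RandomSubgraphs

/-- The number of pairs of times `(i, j)` with `X i = Y j`, as an extended real. -/
noncomputable def numIntersections {V : Type*} (X Y : ℕ → V) : ℝ≥0∞ :=
  ((Set.encard {p : ℕ × ℕ | X p.1 = Y p.2} : ℕ∞) : ℝ≥0∞)

/-! Let `g i` indicate that, given the graph and `Y`, a fresh walk from `Y i` meets the path of `Y`
after time `i` at most `M` times on average. Suppose that `g 0 = 1` with positive probability, all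
means being weighted by the degree of the root. The measure `q z = ∑ i < m, g i * p_m(Y i, z)` has
mean mass of order `m`. Unimodularity makes the walk diffusive, so most of this mass lies in a box
of radius of order `√m`, which has at most of order `m ^ (d / 2) ≤ m ^ 2` points. By Cauchy–Schwarz
`∑ z, q z ^ 2` is then at least of constant order.

On the other hand, reversibility and bounded degree (at most `3 ^ d`) bound `∑ z, q z ^ 2` by a
constant times `∑ g i * g j * p_{2m}(Y i, Y j)`. Grouping the pairs by the earlier time, and using
that graph and walk seen from the walker are stationary, one bounds the mean of this by `m * e m` up
to a constant, where `e m` is the mean of `g 0 * ∑ l, p_{2m}(Y 0, Y l)`. Hence `e m ≥ c / m`, which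
is not summable, whereas the truncation by `g` forces `∑ e m` to be at most `M` times the mean
degree. So the conditional mean number of intersections exceeds every `M` almost surely.

Diffusivity: seen from the middle of a walk of `2 * n` steps, the two halves are independent walks,
so by the variance identity the mean square displacement at most doubles when time doubles.

Graphs are read as relations on the lattice with the root at the origin: re-rooting becomes
translation, and the mass-transport principle becomes `IsReversible`. The argument rests on
`IsReversible.displacement_le`, `HasWalkLaw.map_stepShift`, `le_energy`, `energy_le`,
`not_summable_of_box_bounds` and `IsUnimodular.isReversible`. -/

/-! ### Random walk on a relation on the lattice, and its reversibility. -/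

/-- Points of the lattice `ℤ^d`. -/
abbrev Zd (d : ℕ) : Type := Fin d → ℤ

/-- A relation on the lattice, thought of as the adjacency relation of a graph drawn in `ℤ^d`. -/
abbrev LatticeRel (d : ℕ) : Type := Zd d → Zd d → Prop

/-- The sup-norm box of radius `R` around the origin. -/
noncomputable def latticeBox (d R : ℕ) : Finset (Zd d) :=
  Fintype.piFinset fun _ => Finset.Icc (-(R : ℤ)) R

theorem mem_latticeBox {d R : ℕ} {x : Zd d} : x ∈ latticeBox d R ↔ ∀ k, |x k| ≤ R := by
  simp [latticeBox, abs_le]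

theorem card_latticeBox (d R : ℕ) : (latticeBox d R).card = (2 * R + 1) ^ d := by
  simp only [latticeBox, Fintype.card_piFinset, Int.card_Icc, Finset.prod_const, Finset.card_univ,
    Fintype.card_fin]
  congr 1
  omega

theorem neg_mem_latticeBox {d R : ℕ} {x : Zd d} (h : x ∈ latticeBox d R) :
    -x ∈ latticeBox d R := by
  simpa [mem_latticeBox] using h

theorem add_mem_latticeBox {d R R' : ℕ} {x y : Zd d} (hx : x ∈ latticeBox d R)
    (hy : y ∈ latticeBox d R') : x + y ∈ latticeBox d (R + R') := by
  rw [mem_latticeBox] at *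
  intro k
  push_cast
  exact (abs_add_le _ _).trans (add_le_add (hx k) (hy k))

namespace LatticeRel

variable {d : ℕ}

/-- Two points are neighbours if they are related both ways and at sup-distance at most one. -/
def Nbr (γ : LatticeRel d) (x y : Zd d) : Prop := γ x y ∧ γ y x ∧ y - x ∈ latticeBox d 1

/-- Neighbours, with a loop added at every isolated point. -/
def Link (γ : LatticeRel d) (x y : Zd d) : Prop := Nbr γ x y ∨ (x = y ∧ ∀ z, ¬ Nbr γ x z)

/-- Translation of a relation: `x` becomes the origin. -/
def shift (x : Zd d) (γ : LatticeRel d) : LatticeRel d := fun y z => γ (x + y) (x + z)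

theorem Nbr.symm {γ : LatticeRel d} {x y : Zd d} (h : Nbr γ x y) : Nbr γ y x :=
  ⟨h.2.1, h.1, by simpa using neg_mem_latticeBox h.2.2⟩

theorem Link.symm {γ : LatticeRel d} {x y : Zd d} (h : Link γ x y) : Link γ y x := by
  rcases h with h | ⟨rfl, h⟩
  · exact Or.inl h.symm
  · exact Or.inr ⟨rfl, h⟩

theorem link_comm {γ : LatticeRel d} {x y : Zd d} : Link γ x y ↔ Link γ y x :=
  ⟨Link.symm, Link.symm⟩

theorem Link.sub_mem {γ : LatticeRel d} {x y : Zd d} (h : Link γ x y) :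
    y - x ∈ latticeBox d 1 := by
  rcases h with h | ⟨rfl, h⟩
  · exact h.2.2
  · simp [mem_latticeBox]

theorem exists_link (γ : LatticeRel d) (x : Zd d) : ∃ y, Link γ x y := by
  by_cases h : ∃ z, Nbr γ x z
  · exact h.imp fun z hz => Or.inl hz
  · exact ⟨x, Or.inr ⟨rfl, not_exists.1 h⟩⟩

theorem nbr_shift {γ : LatticeRel d} {a x y : Zd d} :
    Nbr (shift a γ) x y ↔ Nbr γ (a + x) (a + y) := by
  simp [Nbr, shift]

theorem link_shift {γ : LatticeRel d} {a x y : Zd d} :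
    Link (shift a γ) x y ↔ Link γ (a + x) (a + y) := by
  simp only [Link, nbr_shift, add_right_inj]
  refine or_congr_right (and_congr_right fun _ => ?_)
  exact ⟨fun h z => by simpa using h (z - a), fun h z => h _⟩

theorem measurableSet_nbr (x y : Zd d) : MeasurableSet {γ : LatticeRel d | Nbr γ x y} := by
  have h : ∀ x y : Zd d, MeasurableSet {γ : LatticeRel d | γ x y} := fun x y =>
    measurableSet_setOfPred.2 ((measurable_pi_apply y).comp (measurable_pi_apply x))
  exact (h x y).inter ((h y x).inter (MeasurableSet.const _))

theorem measurableSet_link (x y : Zd d) : MeasurableSet {γ : LatticeRel d | Link γ x y} := by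
  refine (measurableSet_nbr x y).union ((MeasurableSet.const _).inter ?_)
  change MeasurableSet {γ : LatticeRel d | ∀ z, ¬ Nbr γ x z}
  rw [Set.ofPred_forall]
  exact MeasurableSet.iInter fun z => (measurableSet_nbr x z).compl

theorem measurable_shift (x : Zd d) : Measurable (shift (d := d) x) :=
  measurable_pi_lambda _ fun y => measurable_pi_lambda _ fun z =>
    (measurable_pi_apply (x + z)).comp (measurable_pi_apply (x + y))

open Classical in
/-- The conductance of a pair of points. -/
noncomputable def cond (γ : LatticeRel d) (x y : Zd d) : ℝ≥0∞ := if Link γ x y then 1 else 0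

/-- The total conductance at a point. -/
noncomputable def wt (γ : LatticeRel d) (x : Zd d) : ℝ≥0∞ := ∑' y, cond γ x y

/-- The `n`-step transition probabilities of the network random walk. -/
noncomputable def trans (γ : LatticeRel d) : ℕ → Zd d → Zd d → ℝ≥0∞
  | 0, x, y => if x = y then 1 else 0
  | n + 1, x, y => ∑' z, cond γ x z / wt γ x * trans γ n z y

theorem cond_comm (γ : LatticeRel d) (x y : Zd d) : cond γ x y = cond γ y x := by
  classical exact if_congr link_comm rfl rfl

theorem cond_shift (γ : LatticeRel d) (a x y : Zd d) :
    cond (shift a γ) x y = cond γ (a + x) (a + y) := by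
  classical exact if_congr link_shift rfl rfl

theorem measurable_cond (x y : Zd d) : Measurable fun γ : LatticeRel d => cond γ x y :=
  Measurable.ite (measurableSet_link x y) measurable_const measurable_const

theorem wt_shift (γ : LatticeRel d) (a x : Zd d) : wt (shift a γ) x = wt γ (a + x) := by
  simp only [wt, cond_shift]
  exact (Equiv.addLeft a).tsum_eq fun y => cond γ (a + x) y

theorem measurable_wt (x : Zd d) : Measurable fun γ : LatticeRel d => wt γ x :=
  Measurable.tsum fun y => measurable_cond x y

theorem one_le_wt (γ : LatticeRel d) (x : Zd d) : 1 ≤ wt γ x := by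
  obtain ⟨y, hy⟩ := exists_link γ x
  calc (1 : ℝ≥0∞) = cond γ x y := by simp [cond, hy]
    _ ≤ wt γ x := ENNReal.le_tsum y

theorem wt_ne_zero (γ : LatticeRel d) (x : Zd d) : wt γ x ≠ 0 :=
  (zero_lt_one.trans_le (one_le_wt γ x)).ne'

theorem wt_le (γ : LatticeRel d) (x : Zd d) : wt γ x ≤ 3 ^ d := by
  have h : wt γ x = ∑ y ∈ (latticeBox d 1).map (addLeftEmbedding x), cond γ x y := by
    refine tsum_eq_sum fun y hy => ?_
    rw [cond, if_neg]
    intro hl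
    exact hy (Finset.mem_map.2 ⟨y - x, hl.sub_mem, by simp⟩)
  rw [h]
  calc ∑ y ∈ (latticeBox d 1).map (addLeftEmbedding x), cond γ x y
      ≤ ∑ y ∈ (latticeBox d 1).map (addLeftEmbedding x), 1 :=
        Finset.sum_le_sum fun y _ => by unfold cond; split_ifs <;> simp
    _ = 3 ^ d := by simp [card_latticeBox]

theorem wt_ne_top (γ : LatticeRel d) (x : Zd d) : wt γ x ≠ ∞ :=
  ne_top_of_le_ne_top (by simp) (wt_le γ x)

theorem trans_zero (γ : LatticeRel d) (x y : Zd d) :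
    trans γ 0 x y = if x = y then 1 else 0 := rfl

theorem trans_succ (γ : LatticeRel d) (n : ℕ) (x y : Zd d) :
    trans γ (n + 1) x y = ∑' z, cond γ x z / wt γ x * trans γ n z y := rfl

theorem trans_one (γ : LatticeRel d) (x y : Zd d) : trans γ 1 x y = cond γ x y / wt γ x := by
  rw [trans_succ, tsum_eq_single y]
  · simp [trans_zero]
  · intro z hz; simp [trans_zero, hz]

theorem tsum_trans_zero_mul (γ : LatticeRel d) (x : Zd d) (f : Zd d → ℝ≥0∞) :
    ∑' y, trans γ 0 x y * f y = f x := by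
  rw [tsum_eq_single x]
  · simp [trans_zero]
  · intro z hz; simp [trans_zero, hz.symm]

theorem measurable_trans (n : ℕ) (x y : Zd d) :
    Measurable fun γ : LatticeRel d => trans γ n x y := by
  induction n generalizing x with
  | zero => exact measurable_const
  | succ n ih =>
    exact Measurable.tsum fun z => ((measurable_cond x z).div (measurable_wt x)).mul (ih z)

theorem trans_shift (γ : LatticeRel d) (a : Zd d) (n : ℕ) (x y : Zd d) :
    trans (shift a γ) n x y = trans γ n (a + x) (a + y) := by
  induction n generalizing x with
  | zero => simp [trans_zero]
  | succ n ih =>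
    simp only [trans_succ, cond_shift, wt_shift, ih]
    exact (Equiv.addLeft a).tsum_eq fun z => cond γ (a + x) z / wt γ (a + x) * trans γ n z (a + y)

/-- The Chapman–Kolmogorov equation. -/
theorem trans_add (γ : LatticeRel d) (m n : ℕ) (x y : Zd d) :
    trans γ (m + n) x y = ∑' z, trans γ m x z * trans γ n z y := by
  induction m generalizing x with
  | zero => simp [tsum_trans_zero_mul]
  | succ m ih =>
    rw [Nat.add_right_comm, trans_succ]
    simp only [ih, trans_succ, ← ENNReal.tsum_mul_left, ← ENNReal.tsum_mul_right]
    rw [ENNReal.tsum_comm]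
    simp only [mul_assoc]

theorem tsum_trans (γ : LatticeRel d) (n : ℕ) (x : Zd d) : ∑' y, trans γ n x y = 1 := by
  induction n generalizing x with
  | zero => simpa using tsum_trans_zero_mul γ x 1
  | succ n ih =>
    simp only [trans_succ]
    rw [ENNReal.tsum_comm]
    simp only [ENNReal.tsum_mul_left, ih, mul_one, div_eq_mul_inv, ENNReal.tsum_mul_right]
    exact ENNReal.mul_inv_cancel (wt_ne_zero γ x) (wt_ne_top γ x)

theorem trans_le_one (γ : LatticeRel d) (n : ℕ) (x y : Zd d) : trans γ n x y ≤ 1 :=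
  (ENNReal.le_tsum y).trans (tsum_trans γ n x).le

theorem wt_mul_step (γ : LatticeRel d) (x y : Zd d) :
    wt γ x * (cond γ x y / wt γ x) = cond γ x y :=
  ENNReal.mul_div_cancel (wt_ne_zero γ x) (wt_ne_top γ x)

/-- The network random walk is reversible. -/
theorem wt_mul_trans (γ : LatticeRel d) (n : ℕ) (x y : Zd d) :
    wt γ x * trans γ n x y = wt γ y * trans γ n y x := by
  induction n generalizing x y with
  | zero =>
    by_cases h : x = y
    · subst h; rfl
    · simp [trans_zero, h, Ne.symm h]
  | succ n ih =>
    have h : ∀ z, wt γ x * (trans γ 1 x z * trans γ n z y) =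
        wt γ y * (trans γ n y z * trans γ 1 z x) := by
      intro z
      rw [trans_one, trans_one]
      calc wt γ x * (cond γ x z / wt γ x * trans γ n z y)
          = wt γ x * (cond γ x z / wt γ x) * trans γ n z y := by ring
        _ = wt γ z * (cond γ z x / wt γ z) * trans γ n z y := by
          rw [wt_mul_step, wt_mul_step, cond_comm]
        _ = wt γ z * trans γ n z y * (cond γ z x / wt γ z) := by ring
        _ = wt γ y * (trans γ n y z * (cond γ z x / wt γ z)) := by rw [ih z y, mul_assoc]
    calc wt γ x * trans γ (n + 1) x y
        = ∑' z, wt γ x * (trans γ 1 x z * trans γ n z y) := by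
          rw [ENNReal.tsum_mul_left, ← trans_add, add_comm]
      _ = wt γ y * trans γ (n + 1) y x := by
          simp only [h]; rw [ENNReal.tsum_mul_left, ← trans_add]

/-- Detailed balance with weights between `1` and `3 ^ d`: reversing time costs a bounded factor. -/
theorem trans_le (γ : LatticeRel d) (n : ℕ) (x y : Zd d) :
    trans γ n x y ≤ 3 ^ d * trans γ n y x :=
  calc trans γ n x y ≤ wt γ x * trans γ n x y := le_mul_of_one_le_left' (one_le_wt γ x)
    _ = wt γ y * trans γ n y x := wt_mul_trans γ n x y
    _ ≤ 3 ^ d * trans γ n y x := by gcongr; exact wt_le γ y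

/-- Finite range turns sums over the walk's position into finite sums, as finiteness and the
variance identity require. -/
theorem trans_eq_zero {γ : LatticeRel d} {n : ℕ} {x y : Zd d} (h : y - x ∉ latticeBox d n) :
    trans γ n x y = 0 := by
  induction n generalizing x with
  | zero =>
    rw [trans_zero, if_neg]
    rintro rfl
    simp [mem_latticeBox] at h
  | succ n ih =>
    rw [trans_succ, ENNReal.tsum_eq_zero]
    intro z
    by_cases hz : y - z ∈ latticeBox d n
    · have : ¬ Link γ x z := fun hl => h (by simpa using add_mem_latticeBox hz hl.sub_mem)
      simp [cond, this]
    · simp [ih hz]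

end LatticeRel

/-! ### Diffusivity of reversible walks. -/

/-- The square of an integer, as an extended nonnegative real. -/
noncomputable def esq (n : ℤ) : ℝ≥0∞ := ((n.natAbs ^ 2 : ℕ) : ℝ≥0∞)

/-- The difference of the two sides is `(2 * a + b) ^ 2`. The unequal weights are what lets the
induction in `IsReversible.displacement_le` close with the constant `6`. -/
theorem two_mul_esq_sub_le (a b : ℤ) : 2 * esq (b - a) ≤ 6 * esq a + 3 * esq b := by
  have h : 2 * (b - a).natAbs ^ 2 ≤ 6 * a.natAbs ^ 2 + 3 * b.natAbs ^ 2 := by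
    zify
    simp only [sq_abs]
    nlinarith [sq_nonneg (2 * a + b)]
  unfold esq
  exact_mod_cast h

theorem esq_ne_top (n : ℤ) : esq n ≠ ∞ := ENNReal.natCast_ne_top _

/-- The variance identity, as an inequality: the mean square distance of two independent copies
of an integer variable is at most twice its second moment. -/
theorem sum_sum_mul_esq_sub_le {ι : Type*} (s : Finset ι) (p : ι → ℝ≥0∞) (hp : ∑ x ∈ s, p x = 1)
    (f : ι → ℤ) :
    ∑ x ∈ s, p x * ∑ y ∈ s, p y * esq (f y - f x) ≤ 2 * ∑ x ∈ s, p x * esq (f x) := by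
  classical
  have hfin : ∀ x ∈ s, p x ≠ ∞ := fun x hx =>
    ne_top_of_le_ne_top ENNReal.one_ne_top (hp ▸ Finset.single_le_sum (fun _ _ => zero_le) hx)
  set q : ι → ℝ≥0 := fun x => (p x).toNNReal
  have hq : ∀ x ∈ s, p x = q x := fun x hx => (ENNReal.coe_toNNReal (hfin x hx)).symm
  have e : ∀ n : ℤ, esq n = ((n.natAbs ^ 2 : ℕ) : ℝ≥0) := fun n => by simp [esq]
  have hq1 : ∑ x ∈ s, q x = 1 := by
    rw [Finset.sum_congr rfl hq] at hp
    exact_mod_cast hp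
  have hq1' : ∑ x ∈ s, (q x : ℝ) = 1 := by exact_mod_cast hq1
  have key : ∑ x ∈ s, q x * ∑ y ∈ s, q y * (((f y - f x).natAbs ^ 2 : ℕ) : ℝ≥0) ≤
      2 * ∑ x ∈ s, q x * (((f x).natAbs ^ 2 : ℕ) : ℝ≥0) := by
    rw [← NNReal.coe_le_coe]
    push_cast
    simp only [Nat.cast_natAbs, Int.cast_abs, sq_abs, Int.cast_sub]
    have h1 : ∀ x, ∑ y ∈ s, (q y : ℝ) * ((f y : ℝ) - f x) ^ 2 =
        ∑ y ∈ s, (q y : ℝ) * (f y : ℝ) ^ 2 - 2 * (f x : ℝ) * ∑ y ∈ s, (q y : ℝ) * f y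
          + (f x : ℝ) ^ 2 := by
      intro x
      have : (f x : ℝ) ^ 2 = ∑ y ∈ s, (q y : ℝ) * (f x : ℝ) ^ 2 := by
        rw [← Finset.sum_mul, hq1', one_mul]
      rw [this, Finset.mul_sum, ← Finset.sum_sub_distrib, ← Finset.sum_add_distrib]
      exact Finset.sum_congr rfl fun y _ => by ring
    have h2 : ∑ x ∈ s, (q x : ℝ) * ∑ y ∈ s, (q y : ℝ) * ((f y : ℝ) - f x) ^ 2 =
        2 * ∑ x ∈ s, (q x : ℝ) * (f x : ℝ) ^ 2 - 2 * (∑ y ∈ s, (q y : ℝ) * f y) ^ 2 := by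
      set A := ∑ y ∈ s, (q y : ℝ) * (f y : ℝ) ^ 2
      set B := ∑ y ∈ s, (q y : ℝ) * f y with hB
      calc _ = ∑ x ∈ s, ((q x : ℝ) * A - 2 * B * ((q x : ℝ) * f x) + (q x : ℝ) * (f x : ℝ) ^ 2) :=
            Finset.sum_congr rfl fun x _ => by rw [h1]; ring
        _ = 2 * A - 2 * B ^ 2 := by
            rw [Finset.sum_add_distrib, Finset.sum_sub_distrib, ← Finset.sum_mul,
              ← Finset.mul_sum, hq1', ← hB]
            ring
    rw [h2]
    linarith [sq_nonneg (∑ y ∈ s, (q y : ℝ) * f y)]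
  have lhs : ∑ x ∈ s, p x * ∑ y ∈ s, p y * esq (f y - f x) =
      ((∑ x ∈ s, q x * ∑ y ∈ s, q y * (((f y - f x).natAbs ^ 2 : ℕ) : ℝ≥0) : ℝ≥0) : ℝ≥0∞) := by
    rw [ENNReal.ofNNReal_finsetSum]
    refine Finset.sum_congr rfl fun x hx => ?_
    rw [ENNReal.coe_mul, ← hq x hx, ENNReal.ofNNReal_finsetSum]
    congr 1
    exact Finset.sum_congr rfl fun y hy => by rw [ENNReal.coe_mul, ← hq y hy, e]
  have rhs : 2 * ∑ x ∈ s, p x * esq (f x) =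
      ((2 * ∑ x ∈ s, q x * (((f x).natAbs ^ 2 : ℕ) : ℝ≥0) : ℝ≥0) : ℝ≥0∞) := by
    rw [ENNReal.coe_mul, ENNReal.ofNNReal_finsetSum]
    congr 1
    exact Finset.sum_congr rfl fun x hx => by rw [ENNReal.coe_mul, ← hq x hx, e]
  rw [lhs, rhs]
  exact_mod_cast key

namespace LatticeRel

variable {d : ℕ}

/-- Invariance, under time reversal and re-rooting, of the law of a random relation together with
a walk from the origin, biased by the weight of the origin. -/
def IsReversible (μ : Measure (LatticeRel d)) : Prop :=
  ∀ (n : ℕ) (h : LatticeRel d → Zd d → ℝ≥0∞), (∀ x, Measurable fun γ => h γ x) →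
    (∀ γ x, h γ x ≠ ∞) →
    ∫⁻ γ, wt γ 0 * ∑' x, trans γ n 0 x * h γ x ∂μ =
      ∫⁻ γ, wt γ 0 * ∑' x, trans γ n 0 x * h (shift x γ) (-x) ∂μ

theorem tsum_trans_mul (γ : LatticeRel d) (n : ℕ) (f : Zd d → ℝ≥0∞) :
    ∑' x, trans γ n 0 x * f x = ∑ x ∈ latticeBox d n, trans γ n 0 x * f x :=
  tsum_eq_sum fun x hx => by rw [trans_eq_zero (by simpa using hx), zero_mul]

/-- The weighted mean square displacement of the walk in a coordinate direction. -/
noncomputable def displacement (μ : Measure (LatticeRel d)) (k : Fin d) (n : ℕ) : ℝ≥0∞ :=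
  ∫⁻ γ, wt γ 0 * ∑' x, trans γ n 0 x * esq (x k) ∂μ

/-- Re-rooting at the position after `m` steps reverses the first `m` steps, so that they and the
last `n` steps become two walks from the origin, independent given the relation. -/
theorem IsReversible.displacement_add {μ : Measure (LatticeRel d)} (hμ : IsReversible μ)
    (k : Fin d) (m n : ℕ) :
    displacement μ k (m + n) =
      ∫⁻ γ, wt γ 0 * ∑' x, trans γ m 0 x * ∑' y, trans γ n 0 y * esq (y k - x k) ∂μ := by
  have h := hμ m (fun γ x => ∑' y, trans γ n x y * esq (y k))
    (fun x => Measurable.tsum fun y => (measurable_trans n x y).mul_const _) ?_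
  · calc displacement μ k (m + n)
        = ∫⁻ γ, wt γ 0 * ∑' x, trans γ m 0 x * ∑' y, trans γ n x y * esq (y k) ∂μ := by
          unfold displacement
          congr with γ
          congr 1
          simp only [trans_add, ← ENNReal.tsum_mul_left, ← ENNReal.tsum_mul_right]
          rw [ENNReal.tsum_comm]
          simp only [mul_assoc]
      _ = _ := h
      _ = _ := by
          congr with γ
          congr 1
          refine tsum_congr fun x => ?_
          congr 1
          simp only [trans_shift, add_neg_cancel]
          rw [← (Equiv.addLeft x).tsum_eq fun y => trans γ n 0 y * esq (y k - x k)]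
          simp
  -- Reversibility is only assumed for finite-valued functions; here finiteness comes from the
  -- finite range of the walk.
  · intro γ x
    have : ∑' y, trans γ n x y * esq (y k) = ∑' y, trans (shift x γ) n 0 y * esq ((x + y) k) := by
      simp only [trans_shift, add_zero]
      exact ((Equiv.addLeft x).tsum_eq fun y => trans γ n x y * esq (y k)).symm
    rw [this, tsum_trans_mul]
    exact ENNReal.sum_ne_top.2 fun y _ => ENNReal.mul_ne_top
      (ne_top_of_le_ne_top ENNReal.one_ne_top (trans_le_one _ _ _ _)) (esq_ne_top _)

theorem measurable_wt_mul_tsum (n : ℕ) (f : Zd d → ℝ≥0∞) :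
    Measurable fun γ : LatticeRel d => wt γ 0 * ∑' x, trans γ n 0 x * f x :=
  (measurable_wt 0).mul (Measurable.tsum fun x => (measurable_trans n 0 x).mul_const _)

/-- The two halves are independent and identically distributed given the relation, so the cross term
of the squared distance is minus twice the square of a mean and can be dropped. -/
theorem IsReversible.displacement_add_self {μ : Measure (LatticeRel d)} (hμ : IsReversible μ)
    (k : Fin d) (n : ℕ) : displacement μ k (n + n) ≤ 2 * displacement μ k n := by
  rw [hμ.displacement_add, displacement, ← lintegral_const_mul _ (measurable_wt_mul_tsum n _)]
  refine lintegral_mono fun γ => ?_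
  rw [mul_left_comm]
  gcongr
  simp only [tsum_trans_mul]
  have h1 : ∑ x ∈ latticeBox d n, trans γ n 0 x = 1 := by
    simpa [tsum_trans] using (tsum_trans_mul γ n fun _ => 1).symm
  exact sum_sum_mul_esq_sub_le (latticeBox d n) (fun x => trans γ n 0 x) h1 fun x => x k

theorem IsReversible.two_mul_displacement_add_le {μ : Measure (LatticeRel d)}
    (hμ : IsReversible μ) (k : Fin d) (m n : ℕ) :
    2 * displacement μ k (m + n) ≤ 6 * displacement μ k m + 3 * displacement μ k n := by
  rw [hμ.displacement_add, ← lintegral_const_mul' _ _ (by simp), displacement, displacement,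
    ← lintegral_const_mul' _ _ (by simp), ← lintegral_const_mul' _ _ (by simp),
    ← lintegral_add_left ((measurable_wt_mul_tsum m _).const_mul _)]
  refine lintegral_mono fun γ => ?_
  rw [mul_left_comm, mul_left_comm 6, mul_left_comm 3, ← mul_add]
  gcongr
  calc 2 * ∑' x, trans γ m 0 x * ∑' y, trans γ n 0 y * esq (y k - x k)
      = ∑' x, trans γ m 0 x * ∑' y, trans γ n 0 y * (2 * esq (y k - x k)) := by
        simp only [← ENNReal.tsum_mul_left]
        refine tsum_congr fun x => tsum_congr fun y => by ring
    _ ≤ ∑' x, trans γ m 0 x * ∑' y, trans γ n 0 y * (6 * esq (x k) + 3 * esq (y k)) := by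
        gcongr
        exact two_mul_esq_sub_le _ _
    _ = _ := by
        simp only [mul_add, ENNReal.tsum_add, ENNReal.tsum_mul_right, tsum_trans, one_mul]
        simp only [← ENNReal.tsum_mul_left]
        congr 1
        · exact tsum_congr fun x => by ring
        · exact tsum_congr fun x => by ring

theorem displacement_zero (μ : Measure (LatticeRel d)) (k : Fin d) : displacement μ k 0 = 0 := by
  simp [displacement, tsum_trans_zero_mul, esq]

theorem displacement_one_le (μ : Measure (LatticeRel d)) (k : Fin d) :
    displacement μ k 1 ≤ ∫⁻ γ, wt γ 0 ∂μ := by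
  refine lintegral_mono fun γ => mul_le_of_le_one_right' ?_
  rw [tsum_trans_mul]
  calc ∑ x ∈ latticeBox d 1, trans γ 1 0 x * esq (x k)
      ≤ ∑ x ∈ latticeBox d 1, trans γ 1 0 x * 1 := by
        refine Finset.sum_le_sum fun x hx => ?_
        gcongr
        have h := mem_latticeBox.1 hx k
        rw [Int.abs_eq_natAbs] at h
        have h' : (x k).natAbs ^ 2 ≤ 1 := Nat.pow_le_one_iff (by simp) |>.2 (by exact_mod_cast h)
        unfold esq
        exact_mod_cast h'
    _ ≤ 1 := by
        simp only [mul_one]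
        exact (ENNReal.sum_le_tsum _).trans (tsum_trans γ 1 0).le

theorem IsReversible.displacement_two_pow_le {μ : Measure (LatticeRel d)} (hμ : IsReversible μ)
    (k : Fin d) (j : ℕ) : displacement μ k (2 ^ j) ≤ 2 ^ j * ∫⁻ γ, wt γ 0 ∂μ := by
  induction j with
  | zero => simpa using displacement_one_le μ k
  | succ j ih =>
    rw [pow_succ', two_mul, pow_succ', mul_assoc]
    exact (hμ.displacement_add_self k _).trans (by gcongr)

/-- The walk is diffusive. -/
theorem IsReversible.displacement_le {μ : Measure (LatticeRel d)} (hμ : IsReversible μ)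
    (k : Fin d) (n : ℕ) : displacement μ k n ≤ 6 * n * ∫⁻ γ, wt γ 0 ∂μ := by
  induction n using Nat.strong_induction_on with
  | _ n ih =>
    rcases Nat.eq_zero_or_pos n with rfl | hn
    · simp [displacement_zero]
    obtain ⟨j, r, hr, rfl⟩ : ∃ j r : ℕ, r < 2 ^ j ∧ n = 2 ^ j + r := by
      refine ⟨Nat.log 2 n, n - 2 ^ Nat.log 2 n, ?_, ?_⟩
      · have := Nat.lt_pow_succ_log_self one_lt_two n
        rw [pow_succ] at this
        have := Nat.pow_log_le_self 2 hn.ne'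
        omega
      · have := Nat.pow_log_le_self 2 hn.ne'
        omega
    have h := hμ.two_mul_displacement_add_le k (2 ^ j) r
    set W := ∫⁻ γ, wt γ 0 ∂μ
    -- The power of two contributes constant `1` and the remainder constant `6`; since `r < 2 ^ j`,
    -- the excess `6 * r` is absorbed by the better constant of the power of two.
    have hr' : (18 * r : ℝ≥0∞) ≤ (6 * 2 ^ j + 12 * r : ℕ) := by
      have : 18 * r ≤ 6 * 2 ^ j + 12 * r := by omega
      exact_mod_cast this
    rw [← ENNReal.mul_le_mul_iff_right (a := 2) (by simp) (by simp)]
    calc 2 * displacement μ k (2 ^ j + r)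
        ≤ 6 * (2 ^ j * W) + 3 * (6 * r * W) := by
          refine h.trans ?_
          gcongr
          · exact hμ.displacement_two_pow_le k j
          · exact ih r (by omega)
      _ = 6 * 2 ^ j * W + 18 * r * W := by ring
      _ ≤ 6 * 2 ^ j * W + (6 * 2 ^ j + 12 * r : ℕ) * W := by gcongr
      _ = 2 * (6 * (2 ^ j + r : ℕ) * W) := by push_cast; ring

end LatticeRel

/-! ### Cylinder sets determine joint laws. -/

section Cylinders

variable {E V : Type*}

/-- The sequences that start with the given finite sequence. -/
def pathCylinder {n : ℕ} (a : Fin (n + 1) → V) : Set (ℕ → V) := {y | ∀ i : Fin (n + 1), y i = a i}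

theorem mem_pathCylinder_iff {n : ℕ} {a : Fin (n + 1) → V} {y : ℕ → V} :
    y ∈ pathCylinder a ↔ (fun i : Fin (n + 1) => y i) = a :=
  funext_iff.symm

theorem measurableSet_pathCylinder [MeasurableSpace V] [MeasurableSingletonClass V] {n : ℕ} (a : Fin (n + 1) → V) :
    MeasurableSet (pathCylinder a) := by
  have : pathCylinder a = ⋂ i : Fin (n + 1), (fun y : ℕ → V => y i) ⁻¹' {a i} := by
    ext y; simp [pathCylinder]
  rw [this]
  exact MeasurableSet.iInter fun i => measurable_pi_apply _ (measurableSet_singleton _)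

/-- Products of measurable sets with cylinders of length at least `N`. -/
def prodCylinders (E V : Type*) [MeasurableSpace E] (N : ℕ) : Set (Set (E × (ℕ → V))) :=
  {s | ∃ A : Set E, MeasurableSet A ∧ ∃ n ≥ N, ∃ a : Fin (n + 1) → V, s = A ×ˢ pathCylinder a}

theorem prod_univ_eq_iUnion (A : Set E) (n : ℕ) :
    A ×ˢ (Set.univ : Set (ℕ → V)) = ⋃ a : Fin (n + 1) → V, A ×ˢ pathCylinder a := by
  ext p
  simp [mem_pathCylinder_iff]

/-- Of two cylinders that meet, the longer is contained in the shorter. -/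
theorem isPiSystem_prodCylinders [MeasurableSpace E] (N : ℕ) : IsPiSystem (prodCylinders E V N) := by
  have main : ∀ (A : Set E), MeasurableSet A → ∀ (n : ℕ), n ≥ N → ∀ (a : Fin (n + 1) → V)
      (A' : Set E), MeasurableSet A' → ∀ (n' : ℕ), n' ≥ N → ∀ (a' : Fin (n' + 1) → V), n ≤ n' →
      ((A ×ˢ pathCylinder a) ∩ (A' ×ˢ pathCylinder a')).Nonempty →
      (A ×ˢ pathCylinder a) ∩ (A' ×ˢ pathCylinder a') ∈ prodCylinders E V N := by
    rintro A hA n hn a A' hA' n' hn' a' hnn ⟨⟨e, y⟩, ⟨he, hy⟩, he', hy'⟩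
    refine ⟨A ∩ A', hA.inter hA', n', hn', a', ?_⟩
    rw [Set.prod_inter_prod]
    congr 1
    refine Set.inter_eq_right.2 fun z hz i => ?_
    have h1 := hz ⟨i, by omega⟩
    have h2 := hy' ⟨i, by omega⟩
    exact (h1.trans h2.symm).trans (hy i)
  rintro _ ⟨A, hA, n, hn, a, rfl⟩ _ ⟨A', hA', n', hn', a', rfl⟩ hne
  rcases le_total n n' with h | h
  · exact main A hA n hn a A' hA' n' hn' a' h hne
  · rw [Set.inter_comm] at hne ⊢
    exact main A' hA' n' hn' a' A hA n hn a h hne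

theorem generateFrom_prodCylinders [MeasurableSpace E] [MeasurableSpace V] [Countable V] [MeasurableSingletonClass V] (N : ℕ) :
    (Prod.instMeasurableSpace : MeasurableSpace (E × (ℕ → V))) =
      MeasurableSpace.generateFrom (prodCylinders E V N) := by
  refine le_antisymm (sup_le ?_ ?_) ?_
  · rintro _ ⟨A, hA, rfl⟩
    rw [← Set.prod_univ, prod_univ_eq_iUnion A N]
    exact MeasurableSet.iUnion fun a =>
      MeasurableSpace.measurableSet_generateFrom ⟨A, hA, N, le_rfl, a, rfl⟩
  · rw [← measurable_iff_comap_le]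
    refine @measurable_pi_lambda _ _ _ (MeasurableSpace.generateFrom (prodCylinders E V N)) _ _
      fun i => ?_
    refine @measurable_to_countable' _ _ _ _ (MeasurableSpace.generateFrom _) _ fun z => ?_
    have : (fun p : E × (ℕ → V) => p.2 i) ⁻¹' {z} =
        ⋃ a : {a : Fin (max N i + 1) → V // a ⟨i, by omega⟩ = z},
          Set.univ ×ˢ pathCylinder a.1 := by
      ext p
      simp [mem_pathCylinder_iff]
    rw [this]
    exact MeasurableSet.iUnion fun a =>
      MeasurableSpace.measurableSet_generateFrom ⟨Set.univ, .univ, _, le_max_left _ _, a.1, rfl⟩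
  · refine MeasurableSpace.generateFrom_le ?_
    rintro _ ⟨A, hA, n, hn, a, rfl⟩
    exact hA.prod (measurableSet_pathCylinder a)

/-- Finite measures that agree on products with long cylinders are equal. -/
theorem ext_of_prodCylinders [MeasurableSpace E] [MeasurableSpace V] [Countable V] [MeasurableSingletonClass V]
    (μ ν : Measure (E × (ℕ → V))) [IsFiniteMeasure μ] (N : ℕ)
    (h : ∀ A : Set E, MeasurableSet A → ∀ n ≥ N, ∀ a : Fin (n + 1) → V,
      μ (A ×ˢ pathCylinder a) = ν (A ×ˢ pathCylinder a)) : μ = ν := by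
  refine ext_of_generate_finite _ (generateFrom_prodCylinders N) (isPiSystem_prodCylinders N) ?_ ?_
  · rintro _ ⟨A, hA, n, hn, a, rfl⟩
    exact h A hA n hn a
  · have hm : ∀ a : Fin (N + 1) → V, MeasurableSet ((Set.univ : Set E) ×ˢ pathCylinder a) :=
      fun a => MeasurableSet.univ.prod (measurableSet_pathCylinder a)
    have hd : Pairwise (Function.onFun Disjoint fun a : Fin (N + 1) → V =>
        (Set.univ : Set E) ×ˢ pathCylinder a) := by
      intro a b hab
      refine Set.disjoint_left.2 ?_
      rintro p ⟨-, h1⟩ ⟨-, h2⟩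
      exact hab ((mem_pathCylinder_iff.1 h1).symm.trans (mem_pathCylinder_iff.1 h2))
    rw [← Set.univ_prod_univ, prod_univ_eq_iUnion _ N, measure_iUnion hd hm, measure_iUnion hd hm]
    exact tsum_congr fun a => h _ .univ N le_rfl a

end Cylinders

/-! ### Joint law of relation and walk, and its stationarity. -/

namespace LatticeRel

variable {d : ℕ}

/-- The probability that the walk from the origin starts with the given finite sequence. -/
noncomputable def pathTrans (γ : LatticeRel d) {n : ℕ} (a : Fin (n + 1) → Zd d) : ℝ≥0∞ :=
  (if a 0 = 0 then 1 else 0) * ∏ i : Fin n, trans γ 1 (a i.castSucc) (a i.succ)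

theorem measurable_pathTrans {n : ℕ} (a : Fin (n + 1) → Zd d) :
    Measurable fun γ : LatticeRel d => pathTrans γ a :=
  measurable_const.mul (Finset.measurable_prod _ fun _ _ => measurable_trans 1 _ _)

theorem pathTrans_le_one (γ : LatticeRel d) {n : ℕ} (a : Fin (n + 1) → Zd d) :
    pathTrans γ a ≤ 1 :=
  mul_le_one' (by split_ifs <;> simp) (Finset.prod_le_one' fun _ _ => trans_le_one _ _ _ _)

/-- The start `x` is arbitrary because the induction peels off the first step. -/
theorem tsum_prod_trans (γ : LatticeRel d) (n : ℕ) (x z : Zd d) :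
    ∑' a : Fin (n + 1) → Zd d, (if a 0 = x then 1 else 0) * (if a (Fin.last n) = z then 1 else 0) *
      ∏ i : Fin n, trans γ 1 (a i.castSucc) (a i.succ) = trans γ n x z := by
  induction n generalizing x with
  | zero =>
    rw [← (Equiv.funUnique (Fin 1) (Zd d)).symm.tsum_eq, tsum_eq_single x]
    · simp [trans_zero]
    · intro y hy
      simp [hy]
  | succ n ih =>
    rw [← (Fin.consEquiv fun _ => Zd d).tsum_eq, ENNReal.tsum_prod', tsum_eq_single x]
    · have h : ∀ a : Fin (n + 1) → Zd d,
          ((if a (Fin.last n) = z then 1 else 0) *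
            (trans γ 1 x (a 0) * ∏ i : Fin n, trans γ 1 (a i.castSucc) (a i.succ)) : ℝ≥0∞) =
          ∑' w, trans γ 1 x w * ((if a 0 = w then 1 else 0) *
            (if a (Fin.last n) = z then 1 else 0) *
              ∏ i : Fin n, trans γ 1 (a i.castSucc) (a i.succ)) := by
        intro a
        rw [tsum_eq_single (a 0)]
        · simp
        · intro w hw
          simp [hw.symm]
      simp only [Fin.consEquiv_apply, Fin.cons_zero, if_true, one_mul, Fin.prod_univ_succ,
        Fin.castSucc_zero, Fin.cons_succ, ← Fin.succ_castSucc, ← Fin.succ_last]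
      simp only [h]
      rw [ENNReal.tsum_comm]
      simp only [ENNReal.tsum_mul_left, ih]
      rw [add_comm, trans_add]
    · intro y hy
      simp [hy]

theorem tsum_pathTrans (γ : LatticeRel d) (n : ℕ) (z : Zd d) :
    ∑' a : Fin (n + 1) → Zd d, (if a (Fin.last n) = z then pathTrans γ a else 0) =
      trans γ n 0 z := by
  rw [← tsum_prod_trans]
  refine tsum_congr fun a => ?_
  unfold pathTrans
  split_ifs <;> simp

theorem pathTrans_cons (γ : LatticeRel d) {n : ℕ} (x : Zd d) (a : Fin (n + 1) → Zd d)
    (ha : a 0 = 0) :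
    pathTrans γ (n := n + 1) (Fin.cons 0 fun i => x + a i : Fin (n + 2) → Zd d) =
      trans γ 1 0 x * pathTrans (shift x γ) a := by
  simp only [pathTrans, Fin.prod_univ_succ (n := n), Fin.castSucc_zero, Fin.cons_zero, if_true,
    Fin.cons_succ, ← Fin.succ_castSucc, ha, add_zero, one_mul, trans_shift]

/-- The joint law of a random relation and of a walk from the origin on it. -/
def HasWalkLaw (ν : Measure (LatticeRel d × (ℕ → Zd d))) : Prop :=
  ∀ (A : Set (LatticeRel d)), MeasurableSet A → ∀ (n : ℕ) (a : Fin (n + 1) → Zd d),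
    ν (A ×ˢ pathCylinder a) = ∫⁻ γ in A, pathTrans γ a ∂ν.fst

variable {ν : Measure (LatticeRel d × (ℕ → Zd d))}

/-- Restricting to a cylinder and forgetting the walk gives the law of the relation with density
`pathTrans γ a`. -/
theorem HasWalkLaw.lintegral_cylinder (hν : HasWalkLaw ν) {n : ℕ} (a : Fin (n + 1) → Zd d)
    {g : LatticeRel d → ℝ≥0∞} (hg : Measurable g) :
    ∫⁻ p in {p | p.2 ∈ pathCylinder a}, g p.1 ∂ν = ∫⁻ γ, g γ * pathTrans γ a ∂ν.fst := by
  have hm : MeasurableSet {p : LatticeRel d × (ℕ → Zd d) | p.2 ∈ pathCylinder a} :=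
    measurable_snd (measurableSet_pathCylinder a)
  have : (ν.restrict {p | p.2 ∈ pathCylinder a}).map Prod.fst =
      ν.fst.withDensity fun γ => pathTrans γ a := by
    ext A hA
    rw [Measure.map_apply measurable_fst hA, Measure.restrict_apply (measurable_fst hA),
      withDensity_apply _ hA, ← hν A hA]
    rfl
  rw [← lintegral_map hg measurable_fst, this,
    lintegral_withDensity_eq_lintegral_mul _ (measurable_pathTrans a) hg]
  simp [mul_comm]

theorem HasWalkLaw.ae_eq_zero (hν : HasWalkLaw ν) : ∀ᵐ p ∂ν, p.2 0 = 0 := by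
  have h : ∀ a : Fin 1 → Zd d, a 0 ≠ 0 → ∀ᵐ p ∂ν, p.2 ∉ pathCylinder a := by
    intro a ha
    have := hν Set.univ .univ 0 a
    rw [Set.univ_prod] at this
    simp only [pathTrans, ha, if_false, zero_mul, lintegral_zero] at this
    simp only [ae_iff, not_not]
    exact this
  have h' := ae_all_iff.2 fun a : {a : Fin 1 → Zd d // a 0 ≠ 0} => h a.1 a.2
  filter_upwards [h'] with p hp
  by_contra hne
  exact hp ⟨fun i => p.2 i, hne⟩ fun i => rfl

/-- The law of the position of the walk at a given time. -/
theorem HasWalkLaw.lintegral_pos (hν : HasWalkLaw ν) (i : ℕ)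
    {g : LatticeRel d → Zd d → ℝ≥0∞} (hg : ∀ x, Measurable fun γ => g γ x) :
    ∫⁻ p, g p.1 (p.2 i) ∂ν = ∫⁻ γ, ∑' x, trans γ i 0 x * g γ x ∂ν.fst := by
  have hm : ∀ a : Fin (i + 1) → Zd d,
      MeasurableSet {p : LatticeRel d × (ℕ → Zd d) | p.2 ∈ pathCylinder a} := fun a =>
    measurable_snd (measurableSet_pathCylinder a)
  have e : ∀ p : LatticeRel d × (ℕ → Zd d), g p.1 (p.2 i) = ∑' a : Fin (i + 1) → Zd d,
      {p : LatticeRel d × (ℕ → Zd d) | p.2 ∈ pathCylinder a}.indicator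
        (fun p => g p.1 (a (Fin.last i))) p := by
    intro p
    rw [tsum_eq_single fun j : Fin (i + 1) => p.2 j]
    · rw [Set.indicator_of_mem]
      · simp
      · exact fun j => rfl
    · intro a ha
      rw [Set.indicator_of_notMem]
      exact fun hp => ha (mem_pathCylinder_iff.1 hp).symm
  calc ∫⁻ p, g p.1 (p.2 i) ∂ν
      = ∑' a : Fin (i + 1) → Zd d, ∫⁻ γ, g γ (a (Fin.last i)) * pathTrans γ a ∂ν.fst := by
        simp only [e]
        rw [lintegral_tsum]
        swap
        · exact fun a => (((hg _).comp measurable_fst).indicator (hm a)).aemeasurable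
        refine tsum_congr fun a => ?_
        rw [lintegral_indicator (hm a), ← hν.lintegral_cylinder a (hg _)]
    _ = ∫⁻ γ, ∑' a : Fin (i + 1) → Zd d, g γ (a (Fin.last i)) * pathTrans γ a ∂ν.fst :=
        (lintegral_tsum fun a => ((hg _).mul (measurable_pathTrans a)).aemeasurable).symm
    _ = _ := by
        congr with γ
        simp only [← tsum_pathTrans, ← ENNReal.tsum_mul_right]
        rw [ENNReal.tsum_comm]
        refine tsum_congr fun a => ?_
        rw [tsum_eq_single (a (Fin.last i))]
        · simp [mul_comm]
        · intro x hx
          simp [hx.symm]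

/-- Re-rooting at the position of the walk after one step, forgetting the first step. -/
def stepShift (p : LatticeRel d × (ℕ → Zd d)) : LatticeRel d × (ℕ → Zd d) :=
  (shift (p.2 1) p.1, fun i => p.2 (i + 1) - p.2 1)

theorem measurable_stepShift : Measurable (stepShift (d := d)) := by
  refine Measurable.prodMk ?_ ?_
  · have h : Measurable fun q : LatticeRel d × Zd d => shift q.2 q.1 :=
      measurable_from_prod_countable_left fun x => measurable_shift x
    exact h.comp (measurable_fst.prodMk ((measurable_pi_apply 1).comp measurable_snd))
  · exact measurable_pi_lambda _ fun i => ((measurable_pi_apply (i + 1)).comp measurable_snd).sub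
      ((measurable_pi_apply 1).comp measurable_snd)

/-- Splitting by the first step `x`, the Markov property gives `trans γ 1 0 x` times the probability
of `a` on the relation seen from `x`; one-step reversibility then moves the root back. -/
theorem HasWalkLaw.lintegral_stepShift_cylinder (hν : HasWalkLaw ν) (hr : IsReversible ν.fst)
    {A : Set (LatticeRel d)} (hA : MeasurableSet A) {n : ℕ} (a : Fin (n + 1) → Zd d) :
    ∫⁻ p in stepShift ⁻¹' (A ×ˢ pathCylinder a), wt p.1 0 ∂ν =
      ∫⁻ p in A ×ˢ pathCylinder a, wt p.1 0 ∂ν := by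
  have hw : Measurable fun γ : LatticeRel d => wt γ 0 := measurable_wt 0
  have hAw : Measurable (A.indicator fun γ : LatticeRel d => wt γ 0) := hw.indicator hA
  have rhs : ∫⁻ p in A ×ˢ pathCylinder a, wt p.1 0 ∂ν =
      ∫⁻ γ, A.indicator (fun γ => wt γ 0) γ * pathTrans γ a ∂ν.fst := by
    rw [← hν.lintegral_cylinder a hAw, Set.prod_eq,
      ← setLIntegral_indicator (measurable_fst hA)]
    rfl
  have hS : MeasurableSet (stepShift ⁻¹' (A ×ˢ pathCylinder a)) :=
    measurable_stepShift (hA.prod (measurableSet_pathCylinder a))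
  by_cases ha : a 0 = 0
  swap
  · have h1 : stepShift ⁻¹' (A ×ˢ pathCylinder a) = ∅ := by
      refine Set.eq_empty_of_forall_notMem fun p hp => ha ?_
      have := hp.2 0
      simpa [stepShift] using this.symm
    rw [rhs, h1]
    simp [pathTrans, ha]
  let c : Zd d → Fin (n + 2) → Zd d := fun x => Fin.cons 0 fun i => x + a i
  let C : Zd d → Set (LatticeRel d × (ℕ → Zd d)) := fun x => {p | p.2 ∈ pathCylinder (c x)}
  have hc : ∀ x, MeasurableSet (C x) := fun x =>
    measurable_snd (measurableSet_pathCylinder (c x))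
  have hsA : ∀ x, Measurable ((shift x ⁻¹' A).indicator fun γ : LatticeRel d => wt γ 0) :=
    fun x => hw.indicator (measurable_shift x hA)
  -- Only the term `x = p.2 1` survives. That the walk starts at the origin is known only almost
  -- surely.
  have e : ∀ᵐ p ∂ν, (stepShift ⁻¹' (A ×ˢ pathCylinder a)).indicator (fun p => wt p.1 0) p =
      ∑' x, (C x).indicator (fun p => (shift x ⁻¹' A).indicator (fun γ => wt γ 0) p.1) p := by
    filter_upwards [hν.ae_eq_zero] with p hp
    rw [tsum_eq_single (p.2 1)]
    · have hmem : p ∈ C (p.2 1) ↔ (stepShift p).2 ∈ pathCylinder a := by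
        constructor
        · intro h i
          have := h i.succ
          simp only [c, Fin.cons_succ, Fin.val_succ] at this
          simp [stepShift, this]
        · intro h i
          refine Fin.cases ?_ (fun i => ?_) i
          · simpa [c] using hp
          · have := h i
            simp only [stepShift] at this
            simp [c, ← this]
      by_cases h1 : (stepShift p).2 ∈ pathCylinder a <;> by_cases h2 : shift (p.2 1) p.1 ∈ A
      · rw [Set.indicator_of_mem, Set.indicator_of_mem (hmem.2 h1), Set.indicator_of_mem]
        · exact h2
        · exact ⟨h2, h1⟩
      · rw [Set.indicator_of_notMem, Set.indicator_of_mem (hmem.2 h1), Set.indicator_of_notMem]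
        · exact h2
        · exact fun h => h2 h.1
      · rw [Set.indicator_of_notMem, Set.indicator_of_notMem]
        · exact fun h => h1 (hmem.1 h)
        · exact fun h => h1 h.2
      · rw [Set.indicator_of_notMem, Set.indicator_of_notMem]
        · exact fun h => h1 (hmem.1 h)
        · exact fun h => h1 h.2
    · intro x hx
      refine Set.indicator_of_notMem (fun h => hx ?_) _
      have := h 1
      simp only [c] at this
      simpa [ha] using this.symm
  rw [rhs, ← lintegral_indicator hS, lintegral_congr_ae e, lintegral_tsum]
  swap
  · exact fun x => (((hsA x).comp measurable_fst).indicator (hc x)).aemeasurable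
  have h1 : ∀ x, ∫⁻ p, (C x).indicator (fun p => (shift x ⁻¹' A).indicator (fun γ => wt γ 0) p.1) p ∂ν =
      ∫⁻ γ, wt γ 0 * (trans γ 1 0 x *
        (A.indicator 1 (shift x γ) * pathTrans (shift x γ) a)) ∂ν.fst := by
    intro x
    rw [lintegral_indicator (hc x), hν.lintegral_cylinder (c x) (hsA x)]
    congr with γ
    rw [pathTrans_cons γ x a ha]
    by_cases h : shift x γ ∈ A
    · rw [Set.indicator_of_mem (show γ ∈ shift x ⁻¹' A from h), Set.indicator_of_mem h]
      simp
    · rw [Set.indicator_of_notMem (show γ ∉ shift x ⁻¹' A from h), Set.indicator_of_notMem h]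
      simp
  simp only [h1]
  have hm1 : Measurable fun γ : LatticeRel d => A.indicator 1 γ * pathTrans γ a :=
    (measurable_one.indicator hA).mul (measurable_pathTrans a)
  rw [← lintegral_tsum]
  swap
  · exact fun x => (hw.mul ((measurable_trans 1 0 x).mul
      (hm1.comp (measurable_shift x)))).aemeasurable
  simp only [ENNReal.tsum_mul_left]
  -- The test function ignores the walk's position, so on the other side the transition
  -- probabilities sum to one.
  rw [← hr 1 (fun γ _ => A.indicator 1 γ * pathTrans γ a) (fun _ => hm1)]
  · congr with γ
    rw [ENNReal.tsum_mul_right, tsum_trans, one_mul]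
    by_cases h : γ ∈ A <;> simp [h]
  · intro γ _
    refine ne_top_of_le_ne_top ENNReal.one_ne_top (mul_le_one' ?_ (pathTrans_le_one _ _))
    exact Set.indicator_le_self _ _ _

/-- The weighted law of relation and walk is stationary. -/
theorem HasWalkLaw.map_stepShift (hν : HasWalkLaw ν) (hr : IsReversible ν.fst)
    [IsFiniteMeasure ν] :
    (ν.withDensity fun p => wt p.1 0).map stepShift = ν.withDensity fun p => wt p.1 0 := by
  have hfin : IsFiniteMeasure (ν.withDensity fun p => wt p.1 0) := by
    refine isFiniteMeasure_withDensity (ne_top_of_le_ne_top ?_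
      (lintegral_mono fun p => wt_le p.1 0))
    rw [lintegral_const]
    exact ENNReal.mul_ne_top (by simp) (measure_ne_top _ _)
  refine ext_of_prodCylinders _ _ 0 fun A hA n _ a => ?_
  have hm := hA.prod (measurableSet_pathCylinder a)
  rw [Measure.map_apply measurable_stepShift hm, withDensity_apply _ hm,
    withDensity_apply _ (measurable_stepShift hm)]
  exact hν.lintegral_stepShift_cylinder hr hA a

/-- Functions of a relation and a sequence that are invariant under translations. -/
def TransInvariant (g : LatticeRel d × (ℕ → Zd d) → ℝ≥0∞) : Prop :=
  ∀ x γ y, g (shift x γ, fun i => y i - x) = g (γ, y)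

/-- For a translation-invariant function the recentring in `stepShift` is invisible, so stationarity
applies to the uncentred tails of the walk. -/
theorem HasWalkLaw.lintegral_wt_mul_shift (hν : HasWalkLaw ν) (hr : IsReversible ν.fst)
    [IsFiniteMeasure ν] {g : LatticeRel d × (ℕ → Zd d) → ℝ≥0∞} (hg : Measurable g)
    (hi : TransInvariant g) (i : ℕ) :
    ∫⁻ p, wt p.1 0 * g (p.1, fun j => p.2 (i + j)) ∂ν = ∫⁻ p, wt p.1 0 * g p ∂ν := by
  have hm : ∀ i : ℕ, Measurable fun p : LatticeRel d × (ℕ → Zd d) =>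
      (p.1, fun j => p.2 (i + j)) := fun i =>
    measurable_fst.prodMk (measurable_pi_lambda _ fun j =>
      (measurable_pi_apply (i + j)).comp measurable_snd)
  have hw : Measurable fun p : LatticeRel d × (ℕ → Zd d) => wt p.1 0 :=
    (measurable_wt 0).comp measurable_fst
  induction i with
  | zero => simp
  | succ i ih =>
    rw [← ih]
    have hgi := hg.comp (hm i)
    have h1 := lintegral_map (μ := ν.withDensity fun p => wt p.1 0) hgi measurable_stepShift
    rw [hν.map_stepShift hr, lintegral_withDensity_eq_lintegral_mul _ hw hgi] at h1
    have h2 := lintegral_withDensity_eq_lintegral_mul ν hw (hgi.comp measurable_stepShift)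
    replace h1 := h1.trans h2
    refine Eq.trans ?_ h1.symm
    congr with p
    simp only [Pi.mul_apply, Function.comp, stepShift]
    rw [hi (p.2 1) p.1 fun j => p.2 (i + j + 1)]
    simp only [Nat.add_right_comm]

end LatticeRel

/-! ### The numerical estimate behind the critical dimension four. -/

/-- A linear form of Cauchy–Schwarz: summed over a box it stays linear in the quantities to be
integrated, and `t` is chosen only at the end. -/
theorem two_mul_mul_le_sq_add_sq (x : ℝ≥0∞) (t : ℝ≥0) : 2 * t * x ≤ x ^ 2 + (t : ℝ≥0∞) ^ 2 := by
  induction x using ENNReal.recTopCoe with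
  | top => simp
  | coe x =>
    have : 2 * t * x ≤ x ^ 2 + t ^ 2 := by
      rw [← NNReal.coe_le_coe]
      push_cast
      nlinarith [sq_nonneg ((x : ℝ) - t)]
    exact_mod_cast this

/-- A sequence obeying these lower bounds is at least of order `1 / m` in dimension at most four,
hence not summable. -/
theorem not_summable_of_box_bounds {d : ℕ} (hd : d ≤ 4) {δ W C : ℝ} (hδ : 0 < δ) (hW : 0 < W)
    (hC : 0 < C) {e : ℕ → ℝ}
    (h : ∀ m R : ℕ, 1 ≤ m → 1 ≤ R → ∀ t : ℝ, 0 < t →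
      2 * t * (m * δ) ≤ C * (m * e m) + (2 * R + 1) ^ d * t ^ 2 * W
        + 2 * t * (m * (12 * d * m * W / R ^ 2))) :
    ¬ Summable e := by
  intro hs
  -- With box radius about `K * √m`, at most half of the density `δ` escapes.
  obtain ⟨K, hK⟩ := exists_nat_gt (24 * d * W / δ)
  have hK1 : (1 : ℝ) ≤ K := by
    have : (0 : ℝ) < K := lt_of_le_of_lt (by positivity) hK
    exact_mod_cast this
  have hKd : 24 * d * W ≤ K * δ := by
    rw [div_lt_iff₀ hδ] at hK
    exact hK.le
  -- With `t = s / m`, this `s` makes the box term at most `s * δ / 2`. The left side is `2 * s * δ`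
  -- and the escape term at most `s * δ`, which leaves `s * δ / 2` for the energy.
  set s : ℝ := δ / (1250 * K ^ 4 * W) with hs_def
  have hs0 : 0 < s := by positivity
  have hsW : 1250 * K ^ 4 * s ^ 2 * W = s * δ := by
    rw [hs_def]; field_simp
  have key : ∀ m : ℕ, 1 ≤ m → s * δ / 2 / C * (1 / m : ℝ) ≤ e m := by
    intro m hm
    have hm0 : (0 : ℝ) < m := by exact_mod_cast hm
    set r := Nat.sqrt m
    have hr1 : 1 ≤ r := Nat.le_sqrt.2 (by omega)
    have hr2 : (r : ℝ) ^ 2 ≤ m := by exact_mod_cast Nat.sqrt_le' m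
    have hr3 : (m : ℝ) ≤ ((r : ℝ) + 1) ^ 2 := by exact_mod_cast (Nat.lt_succ_sqrt' m).le
    have hr1' : (1 : ℝ) ≤ r := by exact_mod_cast hr1
    have hK1' : 1 ≤ K := by exact_mod_cast hK1
    have h1 := h m (K * (r + 1)) hm (Nat.mul_pos hK1' (by omega)) (s / m) (by positivity)
    push_cast at h1
    -- The dimension enters here: for `d ≤ 4` a box of radius of order `√m` has at most of order `m
    -- ^ 2` points.
    have hbox : (2 * ((K : ℝ) * (r + 1)) + 1) ^ d ≤ 625 * K ^ 4 * m ^ 2 := by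
      have hKr : 1 ≤ (K : ℝ) * r := one_le_mul_of_one_le_of_one_le hK1 hr1'
      have hKr2 : (K : ℝ) ≤ K * r := le_mul_of_one_le_right (by positivity) hr1'
      calc (2 * ((K : ℝ) * (r + 1)) + 1) ^ d ≤ (2 * ((K : ℝ) * (r + 1)) + 1) ^ 4 :=
            pow_le_pow_right₀ (by nlinarith) hd
        _ ≤ (5 * (K * r)) ^ 4 := by
            refine pow_le_pow_left₀ (by positivity) ?_ 4
            nlinarith
        _ = 625 * K ^ 4 * ((r : ℝ) ^ 2) ^ 2 := by ring
        _ ≤ 625 * K ^ 4 * m ^ 2 := by gcongr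
    have hout : 12 * d * m * W / ((K : ℝ) * (r + 1)) ^ 2 ≤ δ / 2 := by
      rw [div_le_iff₀ (by positivity)]
      calc 12 * d * m * W = m * (24 * d * W) / 2 := by ring
        _ ≤ m * (K * δ) / 2 := by gcongr
        _ ≤ ((r : ℝ) + 1) ^ 2 * (K ^ 2 * δ) / 2 := by
            gcongr
            nlinarith
        _ = _ := by ring
    have h2 : (2 * ((K : ℝ) * (r + 1)) + 1) ^ d * (s / m) ^ 2 * W ≤ s * δ / 2 := by
      calc (2 * ((K : ℝ) * (r + 1)) + 1) ^ d * (s / m) ^ 2 * W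
          ≤ 625 * K ^ 4 * m ^ 2 * (s / m) ^ 2 * W := by gcongr
        _ = 1250 * K ^ 4 * s ^ 2 * W / 2 := by field_simp; ring
        _ = s * δ / 2 := by rw [hsW]
    have h3 : 2 * (s / m) * (m * (12 * d * m * W / ((K : ℝ) * (r + 1)) ^ 2)) ≤ s * δ := by
      calc _ ≤ 2 * (s / m) * (m * (δ / 2)) := by gcongr
        _ = s * δ := by field_simp
    have h4 : 2 * (s / m) * (m * δ) = 2 * (s * δ) := by field_simp
    have h5 : s * δ / 2 ≤ C * (m * e m) := by linarith
    rw [div_mul_div_comm, div_le_iff₀ (by positivity)]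
    linarith
  have hharm : ¬ Summable fun m : ℕ => s * δ / 2 / C * (1 / m : ℝ) := by
    rw [summable_mul_left_iff (by positivity)]
    exact Real.not_summable_one_div_natCast
  refine hharm ?_
  rw [← summable_nat_add_iff 1] at hs ⊢
  exact Summable.of_nonneg_of_le (fun m => by positivity)
    (fun m => key (m + 1) (by omega)) hs

/-! ### The energy argument for intersections. -/

namespace LatticeRel

variable {d : ℕ} {ν : Measure (LatticeRel d × (ℕ → Zd d))}

/-- The sequence of positions from time `i` on. -/
def tail (i : ℕ) (p : LatticeRel d × (ℕ → Zd d)) : LatticeRel d × (ℕ → Zd d) :=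
  (p.1, fun j => p.2 (i + j))

/-- The mean number of times at which the given path is hit by the `k`-th step of a walk from its
starting point. -/
noncomputable def meanHits (k : ℕ) (p : LatticeRel d × (ℕ → Zd d)) : ℝ≥0∞ :=
  ∑' l, trans p.1 k (p.2 0) (p.2 l)

/-- The mean number of intersections of the given path with a walk from its starting point. -/
noncomputable def meanIntersections (p : LatticeRel d × (ℕ → Zd d)) : ℝ≥0∞ := ∑' k, meanHits k p

theorem measurable_trans_path (k i j : ℕ) :
    Measurable fun p : LatticeRel d × (ℕ → Zd d) => trans p.1 k (p.2 i) (p.2 j) := by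
  have h : Measurable fun q : LatticeRel d × (Zd d × Zd d) => trans q.1 k q.2.1 q.2.2 :=
    measurable_from_prod_countable_left fun x => measurable_trans k x.1 x.2
  have hp : ∀ i, Measurable fun p : LatticeRel d × (ℕ → Zd d) => p.2 i := fun i =>
    (measurable_pi_apply i).comp measurable_snd
  exact h.comp (measurable_fst.prodMk ((hp i).prodMk (hp j)))

theorem measurable_meanHits (k : ℕ) : Measurable (meanHits (d := d) k) :=
  Measurable.tsum fun l => measurable_trans_path k 0 l

theorem measurable_meanIntersections : Measurable (meanIntersections (d := d)) :=
  Measurable.tsum fun k => measurable_meanHits k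

theorem transInvariant_meanHits (k : ℕ) : TransInvariant (meanHits (d := d) k) := by
  intro x γ y
  simp [meanHits, trans_shift]

theorem transInvariant_meanIntersections : TransInvariant (meanIntersections (d := d)) := by
  intro x γ y
  exact tsum_congr fun k => transInvariant_meanHits k x γ y

open Classical in
/-- The indicator of the event that the mean number of intersections is at most `M`. -/
noncomputable def fewIntersections (M : ℝ≥0∞) (p : LatticeRel d × (ℕ → Zd d)) : ℝ≥0∞ :=
  if meanIntersections p ≤ M then 1 else 0

theorem measurable_fewIntersections (M : ℝ≥0∞) : Measurable (fewIntersections (d := d) M) :=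
  Measurable.ite (measurableSet_le measurable_meanIntersections measurable_const)
    measurable_const measurable_const

theorem fewIntersections_le_one (M : ℝ≥0∞) (p : LatticeRel d × (ℕ → Zd d)) :
    fewIntersections M p ≤ 1 := by
  unfold fewIntersections
  split_ifs <;> simp

theorem transInvariant_fewIntersections (M : ℝ≥0∞) :
    TransInvariant (fewIntersections (d := d) M) := by
  intro x γ y
  simp only [fewIntersections, transInvariant_meanIntersections x γ y]

theorem tsum_fewIntersections_mul_meanHits_le (M : ℝ≥0∞) (p : LatticeRel d × (ℕ → Zd d)) :
    ∑' k, fewIntersections M p * meanHits k p ≤ M := by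
  rw [ENNReal.tsum_mul_left, ← meanIntersections]
  unfold fewIntersections
  split_ifs with h
  · simpa using h
  · simp

/-- The energy of the walk during the first `m` steps, for the transition probabilities after
`2 * m` steps, restricted to the times from which there are few intersections. -/
noncomputable def energy (M : ℝ≥0∞) (m : ℕ) (p : LatticeRel d × (ℕ → Zd d)) : ℝ≥0∞ :=
  ∑ i ∈ Finset.range m, ∑ j ∈ Finset.range m, fewIntersections M (tail i p) *
    fewIntersections M (tail j p) * trans p.1 (m + m) (p.2 i) (p.2 j)

/-- A pair with `i ≤ j` is a hit of the path after time `i` by a walk from its position at time `i`.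
The other pairs reduce to these by time reversal, at the cost `3 ^ d`; counting the diagonal twice
is harmless. -/
theorem energy_le (M : ℝ≥0∞) (m : ℕ) (p : LatticeRel d × (ℕ → Zd d)) :
    energy M m p ≤ (1 + 3 ^ d) * ∑ i ∈ Finset.range m,
      fewIntersections M (tail i p) * meanHits (m + m) (tail i p) := by
  let t : ℕ → ℕ → ℝ≥0∞ := fun i j =>
    if i ≤ j then fewIntersections M (tail i p) * trans p.1 (m + m) (p.2 i) (p.2 j) else 0
  have ht : ∀ i, ∑ j ∈ Finset.range m, t i j ≤
      fewIntersections M (tail i p) * meanHits (m + m) (tail i p) := by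
    intro i
    calc ∑ j ∈ Finset.range m, t i j ≤ ∑' j, t i j := ENNReal.sum_le_tsum _
      _ = ∑' l, t i (i + l) := by
          refine ((add_right_injective i).tsum_eq fun j hj => ?_).symm
          have hij : i ≤ j := by
            by_contra hc
            exact hj (if_neg hc)
          exact ⟨j - i, Nat.add_sub_cancel' hij⟩
      _ = _ := by simp [t, ENNReal.tsum_mul_left, meanHits, tail]
  have h1 : ∀ i j, fewIntersections M (tail i p) * fewIntersections M (tail j p) *
      trans p.1 (m + m) (p.2 i) (p.2 j) ≤ t i j + 3 ^ d * t j i := by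
    intro i j
    rcases le_total i j with hij | hij
    · refine le_add_right ?_
      simp only [t, if_pos hij]
      gcongr
      exact mul_le_of_le_one_right' (fewIntersections_le_one _ _)
    · refine le_add_left ?_
      simp only [t, if_pos hij]
      calc _ ≤ 1 * fewIntersections M (tail j p) *
            (3 ^ d * trans p.1 (m + m) (p.2 j) (p.2 i)) := by
            gcongr
            · exact fewIntersections_le_one _ _
            · exact trans_le _ _ _ _
        _ = _ := by ring
  calc energy M m p
      ≤ ∑ i ∈ Finset.range m, ∑ j ∈ Finset.range m, (t i j + 3 ^ d * t j i) :=
        Finset.sum_le_sum fun i _ => Finset.sum_le_sum fun j _ => h1 i j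
    _ = (1 + 3 ^ d) * ∑ i ∈ Finset.range m, ∑ j ∈ Finset.range m, t i j := by
        simp only [Finset.sum_add_distrib, ← Finset.mul_sum]
        rw [Finset.sum_comm (f := fun i j => t j i)]
        ring
    _ ≤ _ := by
        gcongr
        exact ht _

/-- Cauchy–Schwarz on `B` for the measure `q` obtained by running `m` further steps from each
retained point of the path. The last term pays for the mass of `q` outside `B`. -/
theorem le_energy (M : ℝ≥0∞) (m : ℕ) (B : Finset (Zd d)) (t : ℝ≥0)
    (p : LatticeRel d × (ℕ → Zd d)) :
    2 * t * ∑ i ∈ Finset.range m, fewIntersections M (tail i p) ≤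
      3 ^ d * energy M m p + B.card * (t : ℝ≥0∞) ^ 2 +
        2 * t * ∑ i ∈ Finset.range m,
          ∑' z, trans p.1 m (p.2 i) z * (if z ∈ B then 0 else 1) := by
  let g : ℕ → ℝ≥0∞ := fun i => fewIntersections M (tail i p)
  let q : Zd d → ℝ≥0∞ := fun z => ∑ i ∈ Finset.range m, g i * trans p.1 m (p.2 i) z
  have hg : ∀ i, g i ≤ 1 := fun i => fewIntersections_le_one _ _
  have hq : ∑' z, q z ^ 2 ≤ 3 ^ d * energy M m p := by
    calc ∑' z, q z ^ 2 = ∑' z, ∑ i ∈ Finset.range m, ∑ j ∈ Finset.range m,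
          g i * g j * (trans p.1 m (p.2 i) z * trans p.1 m (p.2 j) z) := by
          refine tsum_congr fun z => ?_
          rw [sq, Finset.sum_mul_sum]
          exact Finset.sum_congr rfl fun i _ => Finset.sum_congr rfl fun j _ => by ring
      -- Reversing one of the two walks that meet at `z` joins them into a single walk of `m + m`
      -- steps.
      _ ≤ ∑' z, ∑ i ∈ Finset.range m, ∑ j ∈ Finset.range m,
          g i * g j * (trans p.1 m (p.2 i) z * (3 ^ d * trans p.1 m z (p.2 j))) := by
          gcongr
          exact trans_le _ _ _ _
      _ = ∑ i ∈ Finset.range m, ∑ j ∈ Finset.range m,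
          g i * g j * (3 ^ d * trans p.1 (m + m) (p.2 i) (p.2 j)) := by
          rw [Summable.tsum_finsetSum fun _ _ => ENNReal.summable]
          refine Finset.sum_congr rfl fun i _ => ?_
          rw [Summable.tsum_finsetSum fun _ _ => ENNReal.summable]
          refine Finset.sum_congr rfl fun j _ => ?_
          simp only [mul_left_comm _ ((3 : ℝ≥0∞) ^ d), ENNReal.tsum_mul_left, trans_add]
      _ = 3 ^ d * energy M m p := by
          simp only [energy, Finset.mul_sum]
          exact Finset.sum_congr rfl fun i _ => Finset.sum_congr rfl fun j _ => by ring
  have hB : 2 * t * ∑ z ∈ B, q z ≤ 3 ^ d * energy M m p + B.card * (t : ℝ≥0∞) ^ 2 := by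
    calc 2 * t * ∑ z ∈ B, q z ≤ ∑ z ∈ B, (q z ^ 2 + (t : ℝ≥0∞) ^ 2) := by
          rw [Finset.mul_sum]
          exact Finset.sum_le_sum fun z _ => two_mul_mul_le_sq_add_sq _ _
      _ ≤ _ := by
          rw [Finset.sum_add_distrib, Finset.sum_const, nsmul_eq_mul]
          gcongr
          exact (ENNReal.sum_le_tsum B).trans hq
  have hmass : ∀ i, g i ≤ ∑ z ∈ B, g i * trans p.1 m (p.2 i) z +
      ∑' z, trans p.1 m (p.2 i) z * (if z ∈ B then 0 else 1) := by
    intro i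
    calc g i = ∑' z, g i * trans p.1 m (p.2 i) z := by
          rw [ENNReal.tsum_mul_left, tsum_trans, mul_one]
      _ ≤ ∑' z, ((if z ∈ B then g i * trans p.1 m (p.2 i) z else 0) +
            trans p.1 m (p.2 i) z * (if z ∈ B then 0 else 1)) := by
          refine ENNReal.tsum_le_tsum fun z => ?_
          split_ifs
          · simp
          · simpa using mul_le_of_le_one_left' (hg i)
      _ = _ := by
          rw [ENNReal.tsum_add, tsum_eq_sum (s := B) fun z hz => if_neg hz]
          congr 1
          exact Finset.sum_congr rfl fun z hz => if_pos hz
  calc 2 * t * ∑ i ∈ Finset.range m, g i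
      ≤ 2 * t * ∑ i ∈ Finset.range m, (∑ z ∈ B, g i * trans p.1 m (p.2 i) z +
          ∑' z, trans p.1 m (p.2 i) z * (if z ∈ B then 0 else 1)) := by
        gcongr with i _
        exact hmass i
    _ = 2 * t * ∑ z ∈ B, q z + 2 * t * ∑ i ∈ Finset.range m,
          ∑' z, trans p.1 m (p.2 i) z * (if z ∈ B then 0 else 1) := by
        rw [Finset.sum_add_distrib, Finset.sum_comm, mul_add]
    _ ≤ _ := by gcongr

/-- Chebyshev's inequality: outside the box some coordinate has square at least `R ^ 2`. -/
theorem tsum_trans_mul_compl_box_le (μ : Measure (LatticeRel d)) (hμ : IsReversible μ)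
    (n R : ℕ) :
    R ^ 2 * ∫⁻ γ, wt γ 0 * ∑' z, trans γ n 0 z * (if z ∈ latticeBox d R then 0 else 1) ∂μ ≤
      6 * d * n * ∫⁻ γ, wt γ 0 ∂μ := by
  have hz : ∀ z : Zd d, (R : ℝ≥0∞) ^ 2 * (if z ∈ latticeBox d R then 0 else 1) ≤
      ∑ k, esq (z k) := by
    intro z
    split_ifs with h
    · simp
    · rw [mem_latticeBox, not_forall] at h
      obtain ⟨k, hk⟩ := h
      refine le_trans ?_ (Finset.single_le_sum (fun _ _ => zero_le) (Finset.mem_univ k))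
      have hk' : R ≤ (z k).natAbs := by rw [Int.abs_eq_natAbs] at hk; omega
      rw [mul_one, esq]
      exact_mod_cast Nat.pow_le_pow_left hk' 2
  calc R ^ 2 * ∫⁻ γ, wt γ 0 * ∑' z, trans γ n 0 z * (if z ∈ latticeBox d R then 0 else 1) ∂μ
      = ∫⁻ γ, wt γ 0 * ∑' z, trans γ n 0 z *
          ((R : ℝ≥0∞) ^ 2 * (if z ∈ latticeBox d R then 0 else 1)) ∂μ := by
        rw [← lintegral_const_mul _ (measurable_wt_mul_tsum n _)]
        congr with γ
        rw [mul_left_comm, ← ENNReal.tsum_mul_left]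
        simp only [mul_left_comm]
    _ ≤ ∫⁻ γ, wt γ 0 * ∑' z, trans γ n 0 z * ∑ k, esq (z k) ∂μ := by
        gcongr
        exact hz _
    _ = ∑ k, displacement μ k n := by
        unfold displacement
        rw [← lintegral_finsetSum _ fun k _ => measurable_wt_mul_tsum n _]
        congr with γ
        rw [← Finset.mul_sum, ← Summable.tsum_finsetSum fun _ _ => ENNReal.summable]
        simp only [Finset.mul_sum]
    _ ≤ ∑ _k : Fin d, 6 * n * ∫⁻ γ, wt γ 0 ∂μ := Finset.sum_le_sum fun k _ => hμ.displacement_le k n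
    _ = 6 * d * n * ∫⁻ γ, wt γ 0 ∂μ := by
        rw [Finset.sum_const, Finset.card_univ, Fintype.card_fin, nsmul_eq_mul]
        ring

/-- Running `m` fresh steps from the walk's position at time `i` gives a walk of `i + m ≤ 2 * m`
steps, which doubles the constant `6`. -/
theorem HasWalkLaw.lintegral_exit_le (hν : HasWalkLaw ν) (hr : IsReversible ν.fst) (i m R : ℕ)
    (him : i ≤ m) (hR : R ≠ 0) :
    ∫⁻ p, wt p.1 0 * ∑' z, trans p.1 m (p.2 i) z * (if z ∈ latticeBox d R then 0 else 1) ∂ν ≤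
      12 * d * m * (∫⁻ p, wt p.1 0 ∂ν) / R ^ 2 := by
  let b : Zd d → ℝ≥0∞ := fun z => if z ∈ latticeBox d R then 0 else 1
  have h := hν.lintegral_pos i (g := fun γ x => wt γ 0 * ∑' z, trans γ m x z * b z)
    fun x => (measurable_wt 0).mul (Measurable.tsum fun z => (measurable_trans m x z).mul_const _)
  have h2 : ∫⁻ γ, ∑' x, trans γ i 0 x * (wt γ 0 * ∑' z, trans γ m x z * b z) ∂ν.fst =
      ∫⁻ γ, wt γ 0 * ∑' z, trans γ (i + m) 0 z * b z ∂ν.fst := by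
    congr with γ
    simp only [trans_add, ← ENNReal.tsum_mul_left, ← ENNReal.tsum_mul_right]
    rw [ENNReal.tsum_comm]
    exact tsum_congr fun z => tsum_congr fun x => by ring
  have hW : ∫⁻ p, wt p.1 0 ∂ν = ∫⁻ γ, wt γ 0 ∂ν.fst :=
    (lintegral_map (measurable_wt 0) measurable_fst).symm
  rw [ENNReal.le_div_iff_mul_le (by simp [hR]) (by simp), mul_comm]
  refine (mul_le_mul_right (h.trans h2).le _).trans
    ((tsum_trans_mul_compl_box_le ν.fst hr (i + m) R).trans ?_)
  rw [hW]
  have : (6 * d * (i + m : ℕ) : ℝ≥0∞) ≤ 12 * d * m := by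
    have : 6 * d * (i + m) ≤ 12 * d * m := by nlinarith [Nat.mul_le_mul_left d him]
    exact_mod_cast this
  gcongr

/-- The two energy bounds are combined pointwise and integrated; by stationarity all `m` starting
times contribute equally, whence the factors `m`. -/
theorem HasWalkLaw.box_bound (hν : HasWalkLaw ν) (hr : IsReversible ν.fst) [IsFiniteMeasure ν]
    (M : ℝ≥0∞) (m R : ℕ) (hR : R ≠ 0) (t : ℝ≥0) :
    2 * t * (m * ∫⁻ p, wt p.1 0 * fewIntersections M p ∂ν) ≤
      3 ^ d * (1 + 3 ^ d) *
        (m * ∫⁻ p, wt p.1 0 * (fewIntersections M p * meanHits (m + m) p) ∂ν) +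
      ((2 * R + 1) ^ d : ℕ) * (t : ℝ≥0∞) ^ 2 * ∫⁻ p, wt p.1 0 ∂ν +
      2 * t * (m * (12 * d * m * (∫⁻ p, wt p.1 0 ∂ν) / R ^ 2)) := by
  have hw : Measurable fun p : LatticeRel d × (ℕ → Zd d) => wt p.1 0 :=
    (measurable_wt 0).comp measurable_fst
  have htail : ∀ i, Measurable (tail (d := d) i) := fun i =>
    measurable_fst.prodMk (measurable_pi_lambda _ fun j =>
      (measurable_pi_apply (i + j)).comp measurable_snd)
  let b : Zd d → ℝ≥0∞ := fun z => if z ∈ latticeBox d R then 0 else 1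
  let F : LatticeRel d × (ℕ → Zd d) → ℝ≥0∞ := fun p => fewIntersections M p * meanHits (m + m) p
  have hF : Measurable F := (measurable_fewIntersections M).mul (measurable_meanHits _)
  have hFi : TransInvariant F := fun x γ y => by
    simp only [F, transInvariant_fewIntersections M x γ y, transInvariant_meanHits _ x γ y]
  have hout : ∀ i, Measurable fun p : LatticeRel d × (ℕ → Zd d) =>
      ∑' z, trans p.1 m (p.2 i) z * b z := fun i => by
    have h : Measurable fun q : LatticeRel d × Zd d => ∑' z, trans q.1 m q.2 z * b z :=
      measurable_from_prod_countable_left fun x =>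
        Measurable.tsum fun z => (measurable_trans m x z).mul_const _
    exact h.comp (measurable_fst.prodMk ((measurable_pi_apply i).comp measurable_snd))
  have pointwise : ∀ p : LatticeRel d × (ℕ → Zd d),
      2 * t * ∑ i ∈ Finset.range m, wt p.1 0 * fewIntersections M (tail i p) ≤
      3 ^ d * (1 + 3 ^ d) * ∑ i ∈ Finset.range m, wt p.1 0 * F (tail i p) +
      ((2 * R + 1) ^ d : ℕ) * (t : ℝ≥0∞) ^ 2 * wt p.1 0 +
      2 * t * ∑ i ∈ Finset.range m, wt p.1 0 * ∑' z, trans p.1 m (p.2 i) z * b z := by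
    intro p
    have h1 := le_energy M m (latticeBox d R) t p
    rw [card_latticeBox] at h1
    have h2 := h1.trans (add_le_add_left (add_le_add_left
      (mul_le_mul_right (energy_le M m p) (3 ^ d)) _) _)
    simp only [← Finset.mul_sum]
    calc _ = wt p.1 0 * (2 * t * ∑ i ∈ Finset.range m, fewIntersections M (tail i p)) := by ring
      _ ≤ wt p.1 0 * _ := mul_le_mul_right h2 _
      _ = _ := by simp only [F, b]; ring
  have hint := lintegral_mono (μ := ν) pointwise
  have hmw : ∀ i, Measurable fun p => wt p.1 0 * fewIntersections M (tail i p) := fun i =>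
    hw.mul ((measurable_fewIntersections M).comp (htail i))
  have hmF : ∀ i, Measurable fun p => wt p.1 0 * F (tail i p) := fun i =>
    hw.mul (hF.comp (htail i))
  have hmo : ∀ i, Measurable fun p : LatticeRel d × (ℕ → Zd d) =>
      wt p.1 0 * ∑' z, trans p.1 m (p.2 i) z * b z := fun i => hw.mul (hout i)
  rw [lintegral_const_mul' _ _ (by finiteness), lintegral_finsetSum _ fun i _ => hmw i,
    lintegral_add_right _ ((Finset.measurable_fun_sum _ fun i _ => hmo i).const_mul _),
    lintegral_add_right _ (hw.const_mul _), lintegral_const_mul' _ _ (by finiteness),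
    lintegral_const_mul' _ _ (by finiteness), lintegral_const_mul' _ _ (by finiteness),
    lintegral_finsetSum _ fun i _ => hmF i, lintegral_finsetSum _ fun i _ => hmo i] at hint
  have e1 : ∀ i, ∫⁻ p, wt p.1 0 * fewIntersections M (tail i p) ∂ν =
      ∫⁻ p, wt p.1 0 * fewIntersections M p ∂ν := fun i =>
    hν.lintegral_wt_mul_shift hr (measurable_fewIntersections M)
      (transInvariant_fewIntersections M) i
  have e2 : ∀ i, ∫⁻ p, wt p.1 0 * F (tail i p) ∂ν = ∫⁻ p, wt p.1 0 * F p ∂ν := fun i =>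
    hν.lintegral_wt_mul_shift hr hF hFi i
  simp only [e1, e2, Finset.sum_const, Finset.card_range, nsmul_eq_mul] at hint
  refine hint.trans ?_
  gcongr
  calc ∑ i ∈ Finset.range m, ∫⁻ p, wt p.1 0 * ∑' z, trans p.1 m (p.2 i) z * b z ∂ν
      ≤ ∑ i ∈ Finset.range m, 12 * d * m * (∫⁻ p, wt p.1 0 ∂ν) / R ^ 2 :=
        Finset.sum_le_sum fun i hi =>
          hν.lintegral_exit_le hr i m R (Finset.mem_range.1 hi).le hR
    _ = _ := by simp

/-- In dimension at most four, the mean number of intersections is almost surely infinite. -/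
theorem HasWalkLaw.ae_meanIntersections_eq_top (hν : HasWalkLaw ν) (hr : IsReversible ν.fst)
    [IsFiniteMeasure ν] (hd : d ≤ 4) : ∀ᵐ p ∂ν, meanIntersections p = ∞ := by
  have hw : Measurable fun p : LatticeRel d × (ℕ → Zd d) => wt p.1 0 :=
    (measurable_wt 0).comp measurable_fst
  have hWtop : ∫⁻ p, wt p.1 0 ∂ν ≠ ∞ := by
    refine ne_top_of_le_ne_top ?_ (lintegral_mono fun p => wt_le p.1 0)
    rw [lintegral_const]
    exact ENNReal.mul_ne_top (by simp) (measure_ne_top _ _)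
  have main : ∀ M : ℕ, ∫⁻ p, wt p.1 0 * fewIntersections M p ∂ν = 0 := by
    intro M
    by_contra hδ
    have hδW : ∫⁻ p, wt p.1 0 * fewIntersections M p ∂ν ≤ ∫⁻ p, wt p.1 0 ∂ν :=
      lintegral_mono fun p => mul_le_of_le_one_right' (fewIntersections_le_one _ _)
    let e : ℕ → ℝ≥0∞ := fun m =>
      ∫⁻ p, wt p.1 0 * (fewIntersections M p * meanHits (m + m) p) ∂ν
    have hm : ∀ k, Measurable fun p : LatticeRel d × (ℕ → Zd d) =>
        wt p.1 0 * (fewIntersections M p * meanHits k p) := fun k =>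
      hw.mul ((measurable_fewIntersections M).mul (measurable_meanHits k))
    -- The `e m` are the terms at even times of a series whose sum the truncation bounds by `M`
    -- times the mean weight.
    have he : ∑' m, e m ≠ ∞ := by
      have hinj : Function.Injective fun m : ℕ => m + m := fun a b h => by
        simp only at h; omega
      refine ne_top_of_le_ne_top (ENNReal.mul_ne_top (ENNReal.natCast_ne_top M) hWtop) ?_
      calc ∑' m, e m ≤ ∑' k, ∫⁻ p, wt p.1 0 * (fewIntersections M p * meanHits k p) ∂ν :=
            ENNReal.tsum_comp_le_tsum_of_injective hinj
              fun k => ∫⁻ p, wt p.1 0 * (fewIntersections M p * meanHits k p) ∂ν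
        _ = ∫⁻ p, wt p.1 0 * ∑' k, fewIntersections M p * meanHits k p ∂ν := by
            rw [← lintegral_tsum fun k => (hm k).aemeasurable]
            simp only [ENNReal.tsum_mul_left]
        _ ≤ ∫⁻ p, wt p.1 0 * M ∂ν := by
            gcongr
            exact tsum_fewIntersections_mul_meanHits_le _ _
        _ = M * ∫⁻ p, wt p.1 0 ∂ν := by
            rw [lintegral_mul_const _ hw, mul_comm]
    have hem : ∀ m, e m ≠ ∞ := fun m => ENNReal.ne_top_of_tsum_ne_top he m
    have hδtop := ne_top_of_le_ne_top hWtop hδW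
    refine not_summable_of_box_bounds hd (δ := (∫⁻ p, wt p.1 0 * fewIntersections M p ∂ν).toReal)
      (W := (∫⁻ p, wt p.1 0 ∂ν).toReal) (C := 3 ^ d * (1 + 3 ^ d)) (e := fun m => (e m).toReal)
      (ENNReal.toReal_pos hδ hδtop)
      (ENNReal.toReal_pos (fun h => hδ (le_antisymm (h ▸ hδW) zero_le)) hWtop) (by positivity) ?_
      (ENNReal.summable_toReal he)
    intro m R _ hR t ht
    lift t to ℝ≥0 using ht.le
    have h := hν.box_bound hr M m R (by omega) t
    change _ ≤ 3 ^ d * (1 + 3 ^ d) * (m * e m) + _ + _ at h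
    lift e m to ℝ≥0 using hem m with em
    lift ∫⁻ p, wt p.1 0 * fewIntersections M p ∂ν to ℝ≥0 using hδtop with δ
    lift ∫⁻ p, wt p.1 0 ∂ν to ℝ≥0 using hWtop with W
    have hR' : (R : ℝ≥0) ^ 2 ≠ 0 := by positivity
    have h' : 2 * t * (m * δ) ≤ 3 ^ d * (1 + 3 ^ d) * (m * em) +
        ((2 * R + 1) ^ d : ℕ) * t ^ 2 * W +
        2 * t * (m * (12 * d * m * W / R ^ 2)) := by
      rw [← ENNReal.coe_le_coe]
      simpa [ENNReal.coe_div hR'] using h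
    rw [← NNReal.coe_le_coe] at h'
    simpa using h'
  have h0 : ∀ M : ℕ, ∀ᵐ p ∂ν, ¬ meanIntersections p ≤ M := by
    intro M
    have := (lintegral_eq_zero_iff (hw.mul (measurable_fewIntersections (M : ℝ≥0∞)))).1 (main M)
    filter_upwards [this] with p hp hle
    simp [fewIntersections, hle, wt_ne_zero] at hp
  filter_upwards [ae_all_iff.2 h0] with p hp
  by_contra hne
  obtain ⟨M, hM⟩ := ENNReal.exists_nat_gt hne
  exact hp M hM.le

end LatticeRel

/-! ### Rooted subgraphs as relations on the lattice. -/

theorem EmbeddedGraph.φ_self {d : ℕ} (G : EmbeddedGraph d) (u : G.V) : G.φ u u = 0 :=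
  (G.φ_eq_zero_iff u u).2 rfl

theorem EmbeddedGraph.φ_swap {d : ℕ} (G : EmbeddedGraph d) (u v : G.V) : G.φ v u = -G.φ u v := by
  have h := G.cocycle u v u
  rw [G.φ_self] at h
  exact (neg_eq_of_add_eq_zero_right h.symm).symm

namespace RootedSubgraph

open LatticeRel

variable {d : ℕ} (S : RootedSubgraph d)

theorem pos_root : S.pos S.root = 0 := S.φ_self _

theorem pos_sub_pos (u v : S.V) : S.pos v - S.pos u = S.φ u v := by
  rw [pos, pos, S.cocycle S.root u v, add_sub_cancel_left]

theorem pos_injective : Function.Injective S.pos := fun u v h => by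
  rw [← S.φ_eq_zero_iff, ← pos_sub_pos, h, sub_self]

/-- The adjacency relation of a rooted subgraph, read in the lattice with the root at the
origin. -/
def code : LatticeRel d := fun x y => ∃ u v, S.pos u = x ∧ S.pos v = y ∧ S.graph.Adj u v

variable {S}

theorem nbr_code_iff {x y : Zd d} :
    Nbr S.code x y ↔ ∃ u v, S.pos u = x ∧ S.pos v = y ∧ S.graph.Adj u v := by
  refine ⟨fun h => h.1, ?_⟩
  rintro ⟨u, v, rfl, rfl, h⟩
  refine ⟨⟨u, v, rfl, rfl, h⟩, ⟨v, u, rfl, rfl, h.symm⟩, mem_latticeBox.2 fun k => ?_⟩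
  rw [pos_sub_pos]
  have h1 := norm_le_pi_norm (S.φ u v) k
  rw [S.norm_φ_of_adj u v h, Int.norm_eq_abs] at h1
  exact_mod_cast h1

theorem nbr_code_pos_iff {u : S.V} {y : Zd d} :
    Nbr S.code (S.pos u) y ↔ ∃ v, S.pos v = y ∧ S.graph.Adj u v := by
  rw [nbr_code_iff]
  constructor
  · rintro ⟨u', v, hu, hv, h⟩
    rw [S.pos_injective hu] at h
    exact ⟨v, hv, h⟩
  · rintro ⟨v, hv, h⟩
    exact ⟨u, v, rfl, hv, h⟩

theorem link_code_pos_iff {u : S.V} {y : Zd d} :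
    Link S.code (S.pos u) y ↔
      ∃ v, S.pos v = y ∧ (S.graph.Adj u v ∨ (u = v ∧ S.graph.neighborSet u = ∅)) := by
  have h : (∀ z, ¬ Nbr S.code (S.pos u) z) ↔ S.graph.neighborSet u = ∅ := by
    simp only [nbr_code_pos_iff, Set.eq_empty_iff_forall_notMem, SimpleGraph.mem_neighborSet]
    exact ⟨fun h v hv => h _ ⟨v, rfl, hv⟩, fun h z ⟨v, _, hv⟩ => h v hv⟩
  rw [Link, nbr_code_pos_iff, h]
  constructor
  · rintro (⟨v, hv, h⟩ | ⟨rfl, h⟩)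
    · exact ⟨v, hv, Or.inl h⟩
    · exact ⟨u, rfl, Or.inr ⟨rfl, h⟩⟩
  · rintro ⟨v, rfl, h | ⟨rfl, h⟩⟩
    · exact Or.inl ⟨v, rfl, h⟩
    · exact Or.inr ⟨rfl, h⟩

open Classical in
theorem cond_code_pos (u v : S.V) :
    cond S.code (S.pos u) (S.pos v) =
      if S.graph.Adj u v ∨ (u = v ∧ S.graph.neighborSet u = ∅) then 1 else 0 := by
  refine if_congr (link_code_pos_iff.trans ⟨?_, fun h => ⟨v, rfl, h⟩⟩) rfl rfl
  rintro ⟨v', hv, h⟩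
  rwa [S.pos_injective hv] at h

theorem cond_code_eq_zero {u : S.V} {y : Zd d} (hy : y ∉ Set.range S.pos) :
    cond S.code (S.pos u) y = 0 := by
  refine if_neg fun h => hy ?_
  obtain ⟨v, hv, -⟩ := link_code_pos_iff.1 h
  exact ⟨v, hv⟩

theorem wt_code_pos (u : S.V) : wt S.code (S.pos u) = ∑' v, cond S.code (S.pos u) (S.pos v) := by
  refine (S.pos_injective.tsum_eq fun y hy => ?_).symm
  by_contra h
  exact hy (cond_code_eq_zero h)

/-- The loop that `Link` puts at isolated points matches the rule that the walk stays put at a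
vertex without neighbours. -/
theorem stepProb_eq_trans (u v : S.V) :
    S.stepProb u v = trans S.code 1 (S.pos u) (S.pos v) := by
  classical
  rw [trans_one, wt_code_pos]
  simp only [cond_code_pos]
  by_cases h : S.graph.neighborSet u = ∅
  · have hadj : ∀ w, ¬ S.graph.Adj u w := fun w hw =>
      Set.eq_empty_iff_forall_notMem.1 h w hw
    simp only [EmbeddedGraph.stepProb, h, if_true, hadj, false_or, and_true]
    rw [tsum_eq_single u fun w hw => if_neg hw.symm]
    simp [eq_comm]
  · simp only [EmbeddedGraph.stepProb, h, if_false, and_false, or_false]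
    have : ∑' w, (if S.graph.Adj u w then 1 else 0 : ℝ≥0∞) = (S.graph.neighborSet u).ncard := by
      have h1 := ENNReal.tsum_set_one (S.graph.neighborSet u)
      rw [tsum_subtype (S.graph.neighborSet u) fun _ => (1 : ℝ≥0∞),
        ← (S.locallyFinite u).cast_ncard_eq] at h1
      simpa [Set.indicator_apply] using h1
    rw [this]
    split_ifs <;> simp

/-- Lattice points outside the graph are isolated for the code; they carry loops but cannot be
reached from a vertex. -/
theorem trans_code_eq_zero {u : S.V} {n : ℕ} {y : Zd d} (hy : y ∉ Set.range S.pos) :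
    trans S.code n (S.pos u) y = 0 := by
  induction n generalizing u with
  | zero =>
    refine if_neg ?_
    rintro rfl
    exact hy ⟨u, rfl⟩
  | succ n ih =>
    rw [trans_succ, ENNReal.tsum_eq_zero]
    intro z
    by_cases hz : z ∈ Set.range S.pos
    · obtain ⟨w, rfl⟩ := hz
      rw [ih, mul_zero]
    · rw [cond_code_eq_zero hz, ENNReal.zero_div, zero_mul]

theorem trans_code_zero_eq_zero {n : ℕ} {y : Zd d} (hy : y ∉ Set.range S.pos) :
    trans S.code n 0 y = 0 := by
  rw [← S.pos_root]
  exact trans_code_eq_zero hy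

theorem pathProb_eq_pathTrans {n : ℕ} (w : Fin (n + 1) → S.V) :
    S.pathProb w = pathTrans S.code fun i => S.pos (w i) := by
  have h : S.pos (w 0) = 0 ↔ w 0 = S.root := by
    rw [← S.pos_root]
    exact S.pos_injective.eq_iff
  classical
  unfold pathProb pathTrans
  congr 1
  · exact if_congr h.symm rfl rfl
  · exact Finset.prod_congr rfl fun i _ => stepProb_eq_trans _ _

/-- Positions determine vertices, so at most one vertex path lies over `x`. If there is none, `x`
starts off the origin or takes an impossible step out of the graph, and both sides vanish. -/
theorem posPathProb_eq_pathTrans {n : ℕ} (x : Fin (n + 1) → Zd d) :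
    S.posPathProb x = pathTrans S.code x := by
  by_cases hx : ∀ i, x i ∈ Set.range S.pos
  · choose w hw using hx
    have hu : ∀ w' : {w : Fin (n + 1) → S.V // ∀ i, S.pos (w i) = x i}, w' = ⟨w, hw⟩ := by
      rintro ⟨w', hw'⟩
      ext i
      exact S.pos_injective ((hw' i).trans (hw i).symm)
    rw [posPathProb, tsum_eq_single ⟨w, hw⟩ fun w' hne => absurd (hu w') hne,
      pathProb_eq_pathTrans]
    simp only [hw]
  · have : IsEmpty {w : Fin (n + 1) → S.V // ∀ i, S.pos (w i) = x i} :=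
      ⟨fun w => hx fun i => ⟨w.1 i, w.2 i⟩⟩
    rw [posPathProb, tsum_empty]
    by_contra hne
    refine hx fun i => ?_
    induction i using Fin.induction with
    | zero =>
      refine ⟨S.root, ?_⟩
      rw [S.pos_root]
      by_contra h0
      exact hne (by simp [pathTrans, Ne.symm h0])
    | succ i ih =>
      obtain ⟨u, hu⟩ := ih
      by_contra h1
      refine hne ?_
      have : trans S.code 1 (x i.castSucc) (x i.succ) = 0 := by
        rw [← hu]
        exact trans_code_eq_zero h1
      rw [pathTrans, Finset.prod_eq_zero (Finset.mem_univ i) this, mul_zero]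

theorem code_reroot (v : S.V) :
    (RootedSubgraph.mk S.toEmbeddedGraph v).code = shift (S.pos v) S.code := by
  have h : ∀ u x, (RootedSubgraph.mk S.toEmbeddedGraph v).pos u = x ↔ S.pos u = S.pos v + x := by
    intro u x
    change S.φ v u = x ↔ _
    rw [← pos_sub_pos, sub_eq_iff_eq_add']
  ext x y
  simp only [code, shift, h]

theorem code_eq_of_iso {S T : RootedSubgraph d} (h : Iso S T) : S.code = T.code := by
  obtain ⟨e, he, hr⟩ := h
  have hp : ∀ u, T.pos (e u) = S.pos u := fun u => by rw [pos, ← hr, he]; rfl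
  ext x y
  constructor
  · rintro ⟨u, v, hu, hv, h⟩
    exact ⟨e u, e v, (hp u).trans hu, (hp v).trans hv, e.map_adj_iff.2 h⟩
  · rintro ⟨u, v, hu, hv, h⟩
    refine ⟨e.symm u, e.symm v, ?_, ?_, e.symm.map_adj_iff.2 h⟩
    · rw [← hp, e.apply_symm_apply, hu]
    · rw [← hp, e.apply_symm_apply, hv]

theorem AgreeUpTo.code_pos {S T : RootedSubgraph d} {r : ℕ} (hT : AgreeUpTo r S T) {u v : S.V}
    (hu : S.graph.dist S.root u ≤ r) (hv : S.graph.dist S.root v ≤ r) (h : S.graph.Adj u v) :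
    T.code (S.pos u) (S.pos v) := by
  obtain ⟨e, he, hr⟩ := hT
  have hp : ∀ u, T.pos (e u : T.V) = S.pos u := fun u =>
    (congrArg (fun w => T.φ w (e u)) hr.symm).trans (he _ u)
  exact ⟨e ⟨u, hu⟩, e ⟨v, hv⟩, hp _, hp _, e.map_adj_iff.2 h⟩

/-- The relation coded by an isomorphism class. -/
def Space.code : Space d → LatticeRel d := Quotient.lift RootedSubgraph.code
  fun _ _ h => code_eq_of_iso h

theorem Space.code_cls (S : RootedSubgraph d) : Space.code S.cls = S.code := rfl

/-- Adjacency of two given lattice points is an open condition: once present, it is visible in a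
large enough ball. -/
theorem Space.measurable_code : Measurable (Space.code (d := d)) := by
  refine measurable_pi_lambda _ fun x => measurable_pi_lambda _ fun y => ?_
  refine measurableSet_setOfPred.1 (IsOpen.measurableSet ?_)
  rw [isOpen_iff_forall_mem_open]
  intro q hq
  induction q using Quotient.inductionOn with
  | _ S =>
    obtain ⟨u, v, hu, hv, h⟩ := hq
    set r := max (S.graph.dist S.root u) (S.graph.dist S.root v)
    refine ⟨{q | ∃ T, AgreeUpTo r S T ∧ cls T = q}, ?_,
      TopologicalSpace.isOpen_generateFrom_of_mem ⟨S, r, rfl⟩,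
      S, ⟨SimpleGraph.Iso.refl, fun _ _ => rfl, rfl⟩, rfl⟩
    rintro _ ⟨T, hT, rfl⟩
    subst hu hv
    exact hT.code_pos (le_max_left _ _) (le_max_right _ _) h

end RootedSubgraph

namespace BirootedSubgraph

variable {d : ℕ}

/-- The rooted subgraph obtained by forgetting the second root. -/
def fst (S : BirootedSubgraph d) : RootedSubgraph d := ⟨S.toEmbeddedGraph, S.root₁⟩

/-- The adjacency relation seen from the first root, and the position of the second root. -/
def code (S : BirootedSubgraph d) : LatticeRel d × Zd d := (S.fst.code, S.φ S.root₁ S.root₂)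

theorem code_eq_of_iso {S T : BirootedSubgraph d} (h : Iso S T) : S.code = T.code := by
  obtain ⟨e, he, h₁, h₂⟩ := h
  refine Prod.ext (RootedSubgraph.code_eq_of_iso ⟨e, he, h₁⟩) ?_
  change S.φ S.root₁ S.root₂ = T.φ T.root₁ T.root₂
  rw [← h₁, ← h₂, he]

/-- The code of an isomorphism class. -/
def Space.code : Space d → LatticeRel d × Zd d := Quotient.lift BirootedSubgraph.code
  fun _ _ h => code_eq_of_iso h

theorem isOpen_agree (S : BirootedSubgraph d) (r : ℕ) :
    IsOpen {q : Space d | ∃ T, AgreeUpTo r S T ∧ cls T = q} :=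
  TopologicalSpace.isOpen_generateFrom_of_mem ⟨S, r, rfl⟩

theorem agreeUpTo_refl {S : BirootedSubgraph d} {r : ℕ}
    (h : S.graph.dist S.root₁ S.root₂ ≤ r) : AgreeUpTo r S S :=
  ⟨SimpleGraph.Iso.refl, fun _ _ => rfl, rfl, h, rfl⟩

/-- As for one root, with balls large enough to contain the second root as well; the position of the
second root is locally constant. -/
theorem Space.measurable_code : Measurable (Space.code (d := d)) := by
  refine Measurable.prodMk ?_ ?_
  · refine measurable_pi_lambda _ fun x => measurable_pi_lambda _ fun y => ?_
    refine measurableSet_setOfPred.1 (IsOpen.measurableSet ?_)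
    rw [isOpen_iff_forall_mem_open]
    intro q hq
    induction q using Quotient.inductionOn with
    | _ S =>
      obtain ⟨u, v, hu, hv, h⟩ := hq
      set r := max (max (S.graph.dist S.root₁ u) (S.graph.dist S.root₁ v))
        (S.graph.dist S.root₁ S.root₂)
      refine ⟨_, ?_, isOpen_agree S r, S, agreeUpTo_refl (le_max_right _ _), rfl⟩
      rintro _ ⟨T, ⟨e, he, hr, -⟩, rfl⟩
      have hT : RootedSubgraph.AgreeUpTo r S.fst T.fst := ⟨e, he, hr⟩
      subst hu hv
      exact hT.code_pos (le_max_of_le_left (le_max_left _ _))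
        (le_max_of_le_left (le_max_right _ _)) h
  · refine measurable_to_countable' fun x => IsOpen.measurableSet ?_
    rw [isOpen_iff_forall_mem_open]
    intro q hq
    induction q using Quotient.inductionOn with
    | _ S =>
      refine ⟨_, ?_, isOpen_agree S _, S, agreeUpTo_refl le_rfl, rfl⟩
      rintro _ ⟨T, ⟨e, he, h₁, h, h₂⟩, rfl⟩
      change T.φ T.root₁ T.root₂ = x
      rw [← h₁, ← h₂, he]
      exact hq

end BirootedSubgraph

/-! ### From unimodular graphs to reversible laws, and conditioning on the second walk. -/

theorem sigmaGraphWalk_le_comap {d : ℕ} {Ω : Type*} {S : Ω → RootedSubgraph d}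
    {Y : (ω : Ω) → ℕ → (S ω).V} :
    sigmaGraphWalk S Y ≤
      MeasurableSpace.comap (fun ω => ((S ω).cls, fun j => (S ω).pos (Y ω j))) inferInstance := by
  set κ : Ω → RootedSubgraph.Space d × (ℕ → Zd d) :=
    fun ω => ((S ω).cls, fun j => (S ω).pos (Y ω j))
  have h : Measurable[MeasurableSpace.comap κ inferInstance] κ := comap_measurable κ
  refine sup_le ?_ (iSup_le fun n => ?_)
  · rw [← measurable_iff_comap_le]
    exact measurable_fst.comp h
  · rw [← measurable_iff_comap_le]
    exact ((measurable_pi_apply n).comp measurable_snd).comp h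

section RandomSubgraphs

open LatticeRel

variable {d : ℕ} {Ω : Type*} [MeasurableSpace Ω] {P : Measure Ω} {S : Ω → RootedSubgraph d}

theorem IsUnimodular.measurable_code (hS : IsUnimodular P S) : Measurable fun ω => (S ω).code :=
  RootedSubgraph.Space.measurable_code.comp hS.measurable_cls

/-- Mass transport in which the first root sends `wt γ 0 * trans γ n 0 x * h γ x` to the vertex at
`x`. Exchanging the roots translates the code, and detailed balance restores the weight and the
direction of the walk. -/
theorem IsUnimodular.isReversible (hS : IsUnimodular P S) :
    IsReversible (P.map fun ω => (S ω).code) := by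
  intro n h hm hfin
  let f : LatticeRel d × Zd d → ℝ≥0∞ := fun q => wt q.1 0 * (trans q.1 n 0 q.2 * h q.1 q.2)
  have hf : Measurable f := measurable_from_prod_countable_left fun x =>
    (measurable_wt 0).mul ((measurable_trans n 0 x).mul (hm x))
  have hftop : ∀ q, f q ≠ ∞ := fun q => ENNReal.mul_ne_top (wt_ne_top _ _)
    (ENNReal.mul_ne_top (ne_top_of_le_ne_top ENNReal.one_ne_top (trans_le_one _ _ _ _))
      (hfin _ _))
  have key := hS.massTransport (fun q => (f q.code).toNNReal)
    (hf.comp BirootedSubgraph.Space.measurable_code).ennreal_toNNReal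
  simp only [ENNReal.coe_toNNReal (hftop _)] at key
  have hm1 : Measurable fun γ : LatticeRel d => wt γ 0 * ∑' x, trans γ n 0 x * h γ x :=
    (measurable_wt 0).mul (Measurable.tsum fun x => (measurable_trans n 0 x).mul (hm x))
  have hm2 : Measurable fun γ : LatticeRel d =>
      wt γ 0 * ∑' x, trans γ n 0 x * h (shift x γ) (-x) :=
    (measurable_wt 0).mul (Measurable.tsum fun x =>
      (measurable_trans n 0 x).mul ((hm (-x)).comp (measurable_shift x)))
  rw [lintegral_map hm1 hS.measurable_code, lintegral_map hm2 hS.measurable_code]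
  have sum_range : ∀ (T : RootedSubgraph d) (g : Zd d → ℝ≥0∞),
      ∑' x, trans T.code n 0 x * g x = ∑' v, trans T.code n 0 (T.pos v) * g (T.pos v) := by
    intro T g
    refine (T.pos_injective.tsum_eq fun x hx => ?_).symm
    by_contra hne
    exact hx (by simp only [RootedSubgraph.trans_code_zero_eq_zero hne, zero_mul])
  calc ∫⁻ ω, wt (S ω).code 0 * ∑' x, trans (S ω).code n 0 x * h (S ω).code x ∂P
      = ∫⁻ ω, ∑' v : (S ω).V, f (BirootedSubgraph.Space.code
          (BirootedSubgraph.mk (S ω).toEmbeddedGraph (S ω).root v).cls) ∂P := by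
        congr with ω
        rw [sum_range, ← ENNReal.tsum_mul_left]
        rfl
    _ = _ := key
    _ = _ := by
        congr with ω
        rw [sum_range (S ω) fun x => h (shift x (S ω).code) (-x), ← ENNReal.tsum_mul_left]
        refine tsum_congr fun v => ?_
        have hc : BirootedSubgraph.Space.code
            (BirootedSubgraph.mk (S ω).toEmbeddedGraph v (S ω).root).cls =
            (shift ((S ω).pos v) (S ω).code, -(S ω).pos v) :=
          Prod.ext (RootedSubgraph.code_reroot v) ((S ω).φ_swap (S ω).root v)
        rw [hc]
        simp only [f, wt_shift, trans_shift, add_zero, add_neg_cancel]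
        rw [← mul_assoc, wt_mul_trans, mul_assoc]

variable {X Y : (ω : Ω) → ℕ → (S ω).V}

/-- The joint law of the graph, the position of the first walk at a given time, and the beginning
of the second walk. -/
theorem AreIndepRandomWalks.measure_fst_pos (hXY : AreIndepRandomWalks P S X Y)
    (hS : IsUnimodular P S) {A : Set (RootedSubgraph.Space d)} (hA : MeasurableSet A) (i : ℕ)
    (z : Zd d) {n : ℕ} (a : Fin (n + 1) → Zd d) :
    P {ω | (S ω).cls ∈ A ∧ (S ω).pos (X ω i) = z ∧
        (fun j => (S ω).pos (Y ω j)) ∈ pathCylinder a} =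
      ∫⁻ ω in {ω | (S ω).cls ∈ A}, trans (S ω).code i 0 z * pathTrans (S ω).code a ∂P := by
  let I := {x : Fin (i + 1) → Zd d // x (Fin.last i) = z}
  let E : I → Set Ω := fun x => {ω | (S ω).cls ∈ A ∧
    (∀ k : Fin (i + 1), (S ω).pos (X ω k) = x.1 k) ∧
    (∀ j : Fin (n + 1), (S ω).pos (Y ω j) = a j)}
  have hE : {ω | (S ω).cls ∈ A ∧ (S ω).pos (X ω i) = z ∧
      (fun j => (S ω).pos (Y ω j)) ∈ pathCylinder a} = ⋃ x, E x := by
    ext ω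
    simp only [Set.mem_iUnion, E, pathCylinder, Set.mem_ofPred_eq]
    constructor
    · rintro ⟨h1, h2, h3⟩
      exact ⟨⟨fun k => (S ω).pos (X ω k), by simpa using h2⟩, h1, fun _ => rfl, h3⟩
    · rintro ⟨x, h1, h2, h3⟩
      exact ⟨h1, by simpa [x.2] using h2 (Fin.last i), h3⟩
  have hEm : ∀ x, MeasurableSet (E x) := fun x => by
    refine (hS.measurable_cls hA).inter (MeasurableSet.inter ?_ ?_)
    · exact measurableSet_setOfPred.2 (Measurable.forall fun k => measurableSet_setOfPred.1
        (hXY.measurable_fst k (measurableSet_singleton (x.1 k))))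
    · exact measurableSet_setOfPred.2 (Measurable.forall fun j => measurableSet_setOfPred.1
        (hXY.measurable_snd j (measurableSet_singleton (a j))))
  have hEd : Pairwise (Function.onFun Disjoint E) := by
    intro x x' hne
    refine Set.disjoint_left.2 fun ω h h' => hne (Subtype.ext (funext fun k => ?_))
    exact (h.2.1 k).symm.trans (h'.2.1 k)
  rw [hE, measure_iUnion hEd hEm]
  have hlaw : ∀ x : I, P (E x) = ∫⁻ ω in {ω | (S ω).cls ∈ A},
      pathTrans (S ω).code x.1 * pathTrans (S ω).code a ∂P := fun x => by
    simpa only [RootedSubgraph.posPathProb_eq_pathTrans] using hXY.law A hA i n x.1 a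
  have hpm : ∀ (k : ℕ) (b : Fin (k + 1) → Zd d), Measurable fun ω => pathTrans (S ω).code b :=
    fun k b => (measurable_pathTrans b).comp hS.measurable_code
  simp only [hlaw]
  rw [← lintegral_tsum]
  swap
  · exact fun x => ((hpm _ _).mul (hpm _ _)).aemeasurable
  congr with ω
  rw [ENNReal.tsum_mul_right, ← tsum_pathTrans]
  congr 1
  refine (tsum_subtype {x : Fin (i + 1) → Zd d | x (Fin.last i) = z}
    fun x => pathTrans (S ω).code x).trans ?_
  simp [Set.indicator_apply]

/-- The first walk is integrated out by summing over its position at time `0`. -/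
theorem AreIndepRandomWalks.measure_snd_path (hXY : AreIndepRandomWalks P S X Y)
    (hS : IsUnimodular P S) {A : Set (RootedSubgraph.Space d)} (hA : MeasurableSet A)
    {n : ℕ} (a : Fin (n + 1) → Zd d) :
    P {ω | (S ω).cls ∈ A ∧ (fun j => (S ω).pos (Y ω j)) ∈ pathCylinder a} =
      ∫⁻ ω in {ω | (S ω).cls ∈ A}, pathTrans (S ω).code a ∂P := by
  have hY : Measurable fun ω => fun j => (S ω).pos (Y ω j) :=
    measurable_pi_lambda _ hXY.measurable_snd
  have hE : {ω | (S ω).cls ∈ A ∧ (fun j => (S ω).pos (Y ω j)) ∈ pathCylinder a} =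
      ⋃ z, {ω | (S ω).cls ∈ A ∧ (S ω).pos (X ω 0) = z ∧
        (fun j => (S ω).pos (Y ω j)) ∈ pathCylinder a} := by
    ext ω
    simp
  rw [hE, measure_iUnion]
  · simp only [hXY.measure_fst_pos hS hA]
    rw [← lintegral_tsum]
    · simp only [ENNReal.tsum_mul_right, tsum_trans, one_mul]
    · exact fun z => (((measurable_trans 0 0 z).mul (measurable_pathTrans a)).comp
        hS.measurable_code).aemeasurable
  · intro z z' hne
    exact Set.disjoint_left.2 fun ω h h' => hne (h.2.1.symm.trans h'.2.1)
  · exact fun z => (hS.measurable_cls hA).inter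
      ((hXY.measurable_fst 0 (measurableSet_singleton z)).inter
        (hY (measurableSet_pathCylinder a)))

theorem AreIndepRandomWalks.lintegral_snd_path (hXY : AreIndepRandomWalks P S X Y)
    (hS : IsUnimodular P S) {n : ℕ} (a : Fin (n + 1) → Zd d)
    {g : RootedSubgraph.Space d → ℝ≥0∞} (hg : Measurable g) :
    ∫⁻ ω in {ω | (fun j => (S ω).pos (Y ω j)) ∈ pathCylinder a}, g (S ω).cls ∂P =
      ∫⁻ ω, g (S ω).cls * pathTrans (S ω).code a ∂P := by
  have hp : Measurable fun ω => pathTrans (S ω).code a :=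
    (measurable_pathTrans a).comp hS.measurable_code
  have : (P.restrict {ω | (fun j => (S ω).pos (Y ω j)) ∈ pathCylinder a}).map (fun ω => (S ω).cls) =
      (P.withDensity fun ω => pathTrans (S ω).code a).map fun ω => (S ω).cls := by
    ext A hA
    rw [Measure.map_apply hS.measurable_cls hA, Measure.map_apply hS.measurable_cls hA,
      Measure.restrict_apply (hS.measurable_cls hA), withDensity_apply _ (hS.measurable_cls hA)]
    exact hXY.measure_snd_path hS hA a
  rw [← lintegral_map hg hS.measurable_cls, this, lintegral_map hg hS.measurable_cls]
  refine (lintegral_withDensity_eq_lintegral_mul P hp (hg.comp hS.measurable_cls)).trans ?_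
  simp [mul_comm]

theorem AreIndepRandomWalks.measurable_snd_pos (hXY : AreIndepRandomWalks P S X Y) :
    Measurable fun ω => fun j => (S ω).pos (Y ω j) :=
  measurable_pi_lambda _ hXY.measurable_snd

theorem AreIndepRandomWalks.measurable_code_prodMk (hXY : AreIndepRandomWalks P S X Y)
    (hS : IsUnimodular P S) :
    Measurable fun ω => ((S ω).code, fun j => (S ω).pos (Y ω j)) :=
  hS.measurable_code.prodMk hXY.measurable_snd_pos

theorem AreIndepRandomWalks.fst_map (hXY : AreIndepRandomWalks P S X Y) :
    (P.map fun ω => ((S ω).code, fun j => (S ω).pos (Y ω j))).fst = P.map fun ω => (S ω).code :=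
  Measure.fst_map_prodMk hXY.measurable_snd_pos

theorem AreIndepRandomWalks.hasWalkLaw (hXY : AreIndepRandomWalks P S X Y)
    (hS : IsUnimodular P S) :
    HasWalkLaw (P.map fun ω => ((S ω).code, fun j => (S ω).pos (Y ω j))) := by
  intro A hA n a
  rw [Measure.map_apply (hXY.measurable_code_prodMk hS) (hA.prod (measurableSet_pathCylinder a)),
    hXY.fst_map, setLIntegral_map hA (measurable_pathTrans a) hS.measurable_code]
  exact hXY.measure_snd_path hS (RootedSubgraph.Space.measurable_code hA) a

theorem AreIndepRandomWalks.ae_meanIntersections_eq_top (hXY : AreIndepRandomWalks P S X Y)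
    (hS : IsUnimodular P S) [IsFiniteMeasure P] (hd : d ≤ 4) :
    ∀ᵐ ω ∂P, meanIntersections ((S ω).code, fun j => (S ω).pos (Y ω j)) = ∞ := by
  refine ae_of_ae_map (hXY.measurable_code_prodMk hS).aemeasurable
    ((hXY.hasWalkLaw hS).ae_meanIntersections_eq_top ?_ hd)
  rw [hXY.fst_map]
  exact hS.isReversible

theorem AreIndepRandomWalks.ae_pos_snd_zero (hXY : AreIndepRandomWalks P S X Y)
    (hS : IsUnimodular P S) : ∀ᵐ ω ∂P, (S ω).pos (Y ω 0) = 0 :=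
  ae_of_ae_map (hXY.measurable_code_prodMk hS).aemeasurable (hXY.hasWalkLaw hS).ae_eq_zero

/-- The conditional probability, given the graph and the second walk, that the two walks meet at
given times. -/
theorem AreIndepRandomWalks.measure_inter_meet (hXY : AreIndepRandomWalks P S X Y)
    (hS : IsUnimodular P S) [IsFiniteMeasure P] (i j : ℕ) {B : Set Ω}
    (hB : MeasurableSet[sigmaGraphWalk S Y] B) :
    P (B ∩ {ω | (S ω).pos (X ω i) = (S ω).pos (Y ω j)}) =
      ∫⁻ ω in B, trans (S ω).code i 0 ((S ω).pos (Y ω j)) ∂P := by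
  set κ : Ω → RootedSubgraph.Space d × (ℕ → Zd d) :=
    fun ω => ((S ω).cls, fun j => (S ω).pos (Y ω j))
  have hκm : Measurable κ := hS.measurable_cls.prodMk hXY.measurable_snd_pos
  obtain ⟨D, hD, rfl⟩ := sigmaGraphWalk_le_comap B hB
  have hM : MeasurableSet {ω | (S ω).pos (X ω i) = (S ω).pos (Y ω j)} :=
    measurableSet_eq_fun (hXY.measurable_fst i) (hXY.measurable_snd j)
  have main : (P.restrict {ω | (S ω).pos (X ω i) = (S ω).pos (Y ω j)}).map κ =
      (P.withDensity fun ω => trans (S ω).code i 0 ((S ω).pos (Y ω j))).map κ := by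
    -- Cylinders reaching at least time `j` suffice, and on each of them the position of `Y` at time
    -- `j` is the constant `a j'`.
    refine ext_of_prodCylinders _ _ j fun A hA n hn a => ?_
    have hC := hA.prod (measurableSet_pathCylinder a)
    have hAm : MeasurableSet {ω | (S ω).cls ∈ A} := hS.measurable_cls hA
    let j' : Fin (n + 1) := ⟨j, by omega⟩
    have hset : κ ⁻¹' (A ×ˢ pathCylinder a) = {ω | (S ω).cls ∈ A} ∩
        {ω | (fun j => (S ω).pos (Y ω j)) ∈ pathCylinder a} := rfl
    rw [Measure.map_apply hκm hC, Measure.map_apply hκm hC, Measure.restrict_apply (hκm hC),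
      withDensity_apply _ (hκm hC)]
    have h1 : κ ⁻¹' (A ×ˢ pathCylinder a) ∩ {ω | (S ω).pos (X ω i) = (S ω).pos (Y ω j)} =
        {ω | (S ω).cls ∈ A ∧ (S ω).pos (X ω i) = a j' ∧
          (fun j => (S ω).pos (Y ω j)) ∈ pathCylinder a} := by
      ext ω
      constructor
      · rintro ⟨⟨h1, h2⟩, h3⟩
        exact ⟨h1, h3.trans (h2 j'), h2⟩
      · rintro ⟨h1, h2, h3⟩
        exact ⟨⟨h1, h3⟩, h2.trans (h3 j').symm⟩
    have h2 : ∫⁻ ω in κ ⁻¹' (A ×ˢ pathCylinder a),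
        trans (S ω).code i 0 ((S ω).pos (Y ω j)) ∂P =
        ∫⁻ ω in κ ⁻¹' (A ×ˢ pathCylinder a), trans (S ω).code i 0 (a j') ∂P := by
      refine setLIntegral_congr_fun (hκm hC) fun ω hω => ?_
      exact congrArg (trans (S ω).code i 0) (hω.2 j')
    have hgm : Measurable (A.indicator fun q : RootedSubgraph.Space d =>
        trans q.code i 0 (a j')) :=
      ((measurable_trans i 0 (a j')).comp RootedSubgraph.Space.measurable_code).indicator hA
    rw [h1, hXY.measure_fst_pos hS hA, h2, hset, ← setLIntegral_indicator hAm,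
      ← lintegral_indicator hAm]
    refine Eq.trans ?_ (hXY.lintegral_snd_path hS a hgm).symm
    congr with ω
    by_cases h : (S ω).cls ∈ A
    · rw [Set.indicator_of_mem h, Set.indicator_of_mem (show ω ∈ {ω | (S ω).cls ∈ A} from h),
        RootedSubgraph.Space.code_cls]
    · rw [Set.indicator_of_notMem h,
        Set.indicator_of_notMem (show ω ∉ {ω | (S ω).cls ∈ A} from h), zero_mul]
  have := congrArg (fun μ => μ D) main
  rwa [Measure.map_apply hκm hD, Measure.map_apply hκm hD, Measure.restrict_apply (hκm hD),
    withDensity_apply _ (hκm hD)] at this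

theorem numIntersections_eq_tsum (T : RootedSubgraph d) (x y : ℕ → T.V) :
    numIntersections x y =
      ∑' i, ∑' j, {p : ℕ × ℕ | T.pos (x p.1) = T.pos (y p.2)}.indicator 1 (i, j) := by
  have : {p : ℕ × ℕ | x p.1 = y p.2} = {p : ℕ × ℕ | T.pos (x p.1) = T.pos (y p.2)} := by
    ext p
    exact T.pos_injective.eq_iff.symm
  rw [numIntersections, this, ← ENNReal.tsum_set_one,
    tsum_subtype {p : ℕ × ℕ | T.pos (x p.1) = T.pos (y p.2)} fun _ => (1 : ℝ≥0∞),
    ENNReal.tsum_prod']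
  rfl

/-- This identifies `meanIntersections` as the conditional mean given graph and second walk:
everything is nonnegative, so Tonelli reduces it to one pair of times. Both walks start at the root,
hence the fresh walk may start from `Y 0`. -/
theorem AreIndepRandomWalks.setLIntegral_numIntersections (hXY : AreIndepRandomWalks P S X Y)
    (hS : IsUnimodular P S) [IsFiniteMeasure P] {B : Set Ω}
    (hB : MeasurableSet[sigmaGraphWalk S Y] B) :
    ∫⁻ ω in B, numIntersections (X ω) (Y ω) ∂P =
      ∫⁻ ω in B, meanIntersections ((S ω).code, fun j => (S ω).pos (Y ω j)) ∂P := by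
  have hM : ∀ i j, MeasurableSet {ω | (S ω).pos (X ω i) = (S ω).pos (Y ω j)} := fun i j =>
    measurableSet_eq_fun (hXY.measurable_fst i) (hXY.measurable_snd j)
  have ht : ∀ i j, Measurable fun ω => trans (S ω).code i 0 ((S ω).pos (Y ω j)) := fun i j => by
    have h : Measurable fun q : LatticeRel d × Zd d => trans q.1 i 0 q.2 :=
      measurable_from_prod_countable_left fun x => measurable_trans i 0 x
    exact h.comp (hS.measurable_code.prodMk (hXY.measurable_snd j))
  calc ∫⁻ ω in B, numIntersections (X ω) (Y ω) ∂P
      = ∫⁻ ω in B, ∑' i, ∑' j,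
          {ω | (S ω).pos (X ω i) = (S ω).pos (Y ω j)}.indicator 1 ω ∂P := by
        simp only [numIntersections_eq_tsum]
        rfl
    _ = ∑' i, ∑' j, P (B ∩ {ω | (S ω).pos (X ω i) = (S ω).pos (Y ω j)}) := by
        rw [lintegral_tsum fun i => (Measurable.tsum fun j =>
          measurable_one.indicator (hM i j)).aemeasurable]
        refine tsum_congr fun i => ?_
        rw [lintegral_tsum fun j => (measurable_one.indicator (hM i j)).aemeasurable]
        refine tsum_congr fun j => ?_
        rw [lintegral_indicator_one (hM i j), Measure.restrict_apply (hM i j), Set.inter_comm]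
    _ = ∑' i, ∑' j, ∫⁻ ω in B, trans (S ω).code i 0 ((S ω).pos (Y ω j)) ∂P := by
        simp only [hXY.measure_inter_meet hS _ _ hB]
    _ = ∫⁻ ω in B, ∑' i, ∑' j, trans (S ω).code i 0 ((S ω).pos (Y ω j)) ∂P := by
        rw [lintegral_tsum fun i => (Measurable.tsum fun j => ht i j).aemeasurable]
        refine tsum_congr fun i => ?_
        rw [lintegral_tsum fun j => (ht i j).aemeasurable]
    _ = _ := by
        refine lintegral_congr_ae (ae_restrict_of_ae ?_)
        filter_upwards [hXY.ae_pos_snd_zero hS] with ω hω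
        simp only [meanIntersections, meanHits, hω]

theorem sigmaGraphWalk_le (hS : IsUnimodular P S) (hXY : AreIndepRandomWalks P S X Y) :
    sigmaGraphWalk S Y ≤ ‹MeasurableSpace Ω› :=
  sup_le hS.measurable_cls.comap_le (iSup_le fun n => (hXY.measurable_snd n).comap_le)

end RandomSubgraphs

/-! ### Conclusion. -/

theorem mainTheorem8 (d : ℕ) (hd₁ : 1 ≤ d) (hd₄ : d ≤ 4)
    {Ω : Type*} [MeasurableSpace Ω] (P : Measure Ω) [IsProbabilityMeasure P]
    (S : Ω → RootedSubgraph d) (hS : IsUnimodular P S)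
    (X Y : (ω : Ω) → ℕ → (S ω).V) (hXY : AreIndepRandomWalks P S X Y) :
    ∀ᵐ ω ∂P,
      condLExp (sigmaGraphWalk S Y) P (fun ω' => numIntersections (X ω') (Y ω')) ω = ∞ := by
  have hm := sigmaGraphWalk_le hS hXY
  set c := condLExp (sigmaGraphWalk S Y) P fun ω' => numIntersections (X ω') (Y ω')
  have hc : Measurable[sigmaGraphWalk S Y] c := measurable_condLExp _ _ _
  have h0 : ∀ k : ℕ, P {ω | c ω ≤ k} = 0 := by
    intro k
    have hB : MeasurableSet[sigmaGraphWalk S Y] {ω | c ω ≤ k} := hc measurableSet_Iic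
    -- The event lies in the conditioning σ-algebra, so `c` integrates over it like
    -- `meanIntersections`, which is almost surely infinite; as `c ≤ k` there, the event must be
    -- null.
    have h1 : ∫⁻ ω in {ω | c ω ≤ k}, c ω ∂P = ∞ * P {ω | c ω ≤ k} := by
      rw [setLIntegral_condLExp hm P _ hB, hXY.setLIntegral_numIntersections hS hB,
        ← setLIntegral_const]
      exact lintegral_congr_ae (ae_restrict_of_ae (hXY.ae_meanIntersections_eq_top hS hd₄))
    have h2 : ∫⁻ ω in {ω | c ω ≤ k}, c ω ∂P ≤ k * P {ω | c ω ≤ k} := by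
      rw [← setLIntegral_const]
      exact setLIntegral_mono measurable_const fun ω hω => hω
    by_contra hne
    rw [h1, ENNReal.top_mul hne] at h2
    exact ENNReal.mul_ne_top (ENNReal.natCast_ne_top k) (measure_ne_top P _) (top_le_iff.1 h2)
  have h1 : ∀ᵐ ω ∂P, ∀ k : ℕ, ¬ c ω ≤ k := by
    rw [ae_all_iff]
    intro k
    rw [ae_iff]
    simpa only [not_not] using h0 k
  filter_upwards [h1] with ω hω
  by_contra hne
  obtain ⟨k, hk⟩ := ENNReal.exists_nat_gt hne
  exact hω k hk.le
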